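/- **Setting.** Let $\mathsf Z$ be a Polish space with its Borel $\sigma$-field, $\mathrm Q$ a Markov kernel on $\mathsf Z$ with invariant probability measure $\pi$, and suppose that for some integer $t_{\rm mix}\ge 1$, for all $k\ge 1$, $$\Delta(\mathrm Q^k):=\sup_{z,z'\in\mathsf Z}\tfrac12\|\mathrm Q^k(z,\cdot)-\mathrm Q^k(z',\cdot)\|_{\rm TV}\le (1/4)^{\lfloor k/t_{\rm mix}\rfloor},$$ where $\|\mu\|_{\rm TV}=|\mu|(\mathsf Z)$. Let $d\ge 1$, let $\mathbf A:\mathsf Z\to\mathbb R^{d\times d}$ and $\mathbf b:\mathsf Z\to\mathbb R^d$ be measurable, with $\int\mathbf A\,d\pi=\bar{\mathbf A}$ and $\int\mathbf b\,d\pi=\bar{\mathbf b}$. Assume that $-\bar{\mathbf A}$ is Hurwitz, let $\theta^\star$ be the solution of $\bar{\mathbf A}\theta^\star=\bar{\mathbf b}$, and put $\tilde{\mathbf A}(z)=\mathbf A(z)-\bar{\mathbf A}$ and $\varepsilon(z)=\tilde{\mathbf A}(z)\theta^\star-(\mathbf b(z)-\bar{\mathbf b})$. Assume $$C_{\mathbf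 A}=\sup_z\|\mathbf A(z)\|\vee\sup_z\|\tilde{\mathbf A}(z)\|<\infty,\qquad \|\varepsilon\|_\infty=\sup_z\|\varepsilon(z)\|<\infty$$ (Euclidean and spectral norms). **Step size threshold.** Let $Q$ be the unique symmetric positive definite solution of $\bar{\mathbf A}^\top Q+Q\bar{\mathbf A}=\mathrm I$, let $\|x\|_Q=(x^\top Qx)^{1/2}$, let $\|\cdot\|_Q$ also denote the induced operator norm, and set $\kappa_Q=\lambda_{\max}(Q)/\lambda_{\min}(Q)$, $a=\|Q\|^{-1}/2$, $\alpha_\infty=\tfrac12\|\bar{\mathbf A}\|_Q^{-2}\|Q\|^{-1}\wedge\|Q\|$, $N=\lceil 8\kappa_Q^{1/2}C_{\mathbf A}/a\rceil$, $C_\Gamma=4(\kappa_Q^{1/2}C_{\mathbf A}+a/6)^2N$, $$\alpha^{(M)}_\infty=\Big[\alpha_\infty\wedge\kappa_Q^{-1/2}C_{\mathbf A}^{-1}\wedge\frac{a}{6\mathrm e\,\kappa_Q C_{\mathbf A}}\Big]N^{-1},\qquad \alpha^{(M)}_{q,\infty}=\alpha^{(M)}_\infty\wedge\frac{a}{12\,C_\Gamma\,q},$$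 $$\alpha^{(b)}_\infty=\Big(\alpha^{(M)}_{2(1+\log d),\infty}\wedge\frac1{1+C_{\mathbf A}}\wedge\frac1{2a}\Big)t_{\rm mix}^{-1}.$$ **Processes.** For a Markov chain $(Z_k)_{k\ge0}$ with kernel $\mathrm Q$ and arbitrary initial distribution, set $J^{(0,\alpha)}_0=J^{(1,\alpha)}_0=0$ and, for $n\ge1$, $$J^{(0,\alpha)}_n=(\mathrm I-\alpha\bar{\mathbf A})J^{(0,\alpha)}_{n-1}-\alpha\,\varepsilon(Z_n),\qquad J^{(1,\alpha)}_n=(\mathrm I-\alpha\bar{\mathbf A})J^{(1,\alpha)}_{n-1}-\alpha\,\tilde{\mathbf A}(Z_n)J^{(0,\alpha)}_{n-1}.$$ **Proposition.** Let $\alpha\in(0,\alpha^{(b)}_\infty)$. The Markov kernel on $\mathsf Z\times\mathbb R^d\times\mathbb R^d$ of the chain $Y_t=(Z_{t+1},J^{(0,\alpha)}_t,J^{(1,\alpha)}_t)$ has a unique invariant probability measure; let $(Z_{\infty+1},J^{(0,\alpha)}_\infty,J^{(1,\alpha)}_\infty)$ be distributed according to it. Then $J^{(1,\alpha)}_\infty$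 and all $J^{(1,\alpha)}_n$ are integrable, and for every initial distribution $$\lim_{n\to\infty}\mathbb E[J^{(1,\alpha)}_n]=\mathbb E[J^{(1,\alpha)}_\infty]=\alpha\Delta+R(\alpha),\qquad \Delta=\bar{\mathbf A}^{-1}\sum_{k=1}^\infty\mathbb E[\tilde{\mathbf A}(Z_{\infty+k})\,\varepsilon(Z_\infty)],$$ where the series converges, $Z_\infty\sim\pi$ and $Z_{\infty+k}\sim\mathrm Q^k(Z_\infty,\cdot)$ given $Z_\infty$, and $$\|R(\alpha)\|\le 12\,\|\bar{\mathbf A}^{-1}\|\,C_{\mathbf A}^2\,t_{\rm mix}^2\,\alpha^2\,\|\varepsilon\|_\infty .$$ -/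

import Mathlib

open MeasureTheory ProbabilityTheory Filter Topology
open scoped ENNReal Matrix.Norms.L2Operator

/-! The norm `‖M‖` of a real matrix is the spectral norm (the operator norm for the Euclidean
norm), and vectors live in `EuclideanSpace ℝ (Fin d)`. -/

namespace LSA

/-- The matrix-vector product, on Euclidean space. -/
noncomputable abbrev act {d : ℕ} (M : Matrix (Fin d) (Fin d) ℝ) (x : EuclideanSpace ℝ (Fin d)) :
    EuclideanSpace ℝ (Fin d) :=
  Matrix.toEuclideanCLM (n := Fin d) (𝕜 := ℝ) M x

/-- A real square matrix is Hurwitz if all its complex eigenvalues have negative real part. -/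
def IsHurwitz {d : ℕ} (M : Matrix (Fin d) (Fin d) ℝ) : Prop :=
  ∀ μ ∈ spectrum ℂ (M.map (algebraMap ℝ ℂ)), μ.re < 0

section Chain

variable {Z : Type*} [MeasurableSpace Z]

instance isMarkovKernel_pow (Q : Kernel Z Z) [IsMarkovKernel Q] (k : ℕ) :
    IsMarkovKernel (Q ^ k) := by
  induction k with
  | zero => exact inferInstanceAs (IsMarkovKernel (Kernel.id : Kernel Z Z))
  | succ k ih => rw [pow_succ]; exact inferInstanceAs (IsMarkovKernel ((Q ^ k) ∘ₖ Q))

/-- The total variation norm `|μ - ν|(Z)` of the difference of two finite measures. -/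
noncomputable def tvNorm (μ ν : Measure Z) [IsFiniteMeasure μ] [IsFiniteMeasure ν] : ℝ≥0∞ :=
  (μ.toSignedMeasure - ν.toSignedMeasure).totalVariation Set.univ

/-- The Dobrushin coefficient `sup_{z, z'} (1/2) ‖κ(z, ·) - κ(z', ·)‖_TV`. -/
noncomputable def dobrushin (κ : Kernel Z Z) [IsMarkovKernel κ] : ℝ≥0∞ :=
  ⨆ (z : Z) (z' : Z), tvNorm (κ z) (κ z') / 2

/-- `Q` has mixing time (at most) `t`: `Δ(Q^k) ≤ (1/4)^⌊k/t⌋` for all `k ≥ 1`. The division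
`k / t` is the floor division of natural numbers. -/
def HasMixingTime (Q : Kernel Z Z) [IsMarkovKernel Q] (t : ℕ) : Prop :=
  ∀ k : ℕ, 1 ≤ k → dobrushin (Q ^ k) ≤ (1 / 4 : ℝ≥0∞) ^ (k / t)

/-- `(X_n)_{n ≥ 0}` is a Markov chain with kernel `Q` under `P` (with arbitrary initial law):
given the past `(X_0, …, X_n)`, the law of `X_{n+1}` is `Q(X_n, ·)`. -/
def IsMarkovChain {Ω : Type*} [MeasurableSpace Ω] (P : Measure Ω) (Q : Kernel Z Z)
    (X : ℕ → Ω → Z) : Prop :=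
  (∀ n, Measurable (X n)) ∧
  ∀ n : ℕ, HasCondDistrib (X (n + 1)) (fun ω (i : Finset.Iic n) => X i ω)
    (Q.comap (fun x : Finset.Iic n → Z => x ⟨n, Finset.mem_Iic.2 le_rfl⟩)
      (measurable_pi_apply _)) P

end Chain

section Model

variable {Z : Type*} {d : ℕ}

/-- The centered matrix function `Ã(z) = A(z) - Ā`. -/
def tildeA (A : Z → Matrix (Fin d) (Fin d) ℝ) (Abar : Matrix (Fin d) (Fin d) ℝ) (z : Z) :
    Matrix (Fin d) (Fin d) ℝ :=
  A z - Abar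

/-- The noise `ε(z) = Ã(z) θ⋆ - (b(z) - b̄)`. -/
noncomputable def noise (A : Z → Matrix (Fin d) (Fin d) ℝ) (b : Z → EuclideanSpace ℝ (Fin d))
    (Abar : Matrix (Fin d) (Fin d) ℝ) (bbar θ : EuclideanSpace ℝ (Fin d)) (z : Z) :
    EuclideanSpace ℝ (Fin d) :=
  act (tildeA A Abar z) θ - (b z - bbar)

/-- The constant `C_A = sup_z ‖A(z)‖ ∨ sup_z ‖Ã(z)‖`. -/
noncomputable def constA (A : Z → Matrix (Fin d) (Fin d) ℝ) (Abar : Matrix (Fin d) (Fin d) ℝ) :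
    ℝ :=
  max (⨆ z, ‖A z‖) (⨆ z, ‖tildeA A Abar z‖)

/-- The sup norm `‖g‖_∞ = sup_z ‖g(z)‖`. -/
noncomputable def supNorm (g : Z → EuclideanSpace ℝ (Fin d)) : ℝ := ⨆ z, ‖g z‖

/-- `J_n^{(0,α)}` along a realization `w` of the chain: `J_0 = 0` and
`J_n = (I - αĀ) J_{n-1} - α ε(w_n)`. -/
noncomputable def J0 (α : ℝ) (Abar : Matrix (Fin d) (Fin d) ℝ)
    (eps : Z → EuclideanSpace ℝ (Fin d)) (w : ℕ → Z) : ℕ → EuclideanSpace ℝ (Fin d)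
  | 0 => 0
  | n + 1 => act (1 - α • Abar) (J0 α Abar eps w n) - α • eps (w (n + 1))

/-- `J_n^{(1,α)}` along a realization `w` of the chain: `J_0 = 0` and
`J_n^{(1)} = (I - αĀ) J_{n-1}^{(1)} - α Ã(w_n) J_{n-1}^{(0)}`. Here `G` stands for `Ã`. -/
noncomputable def J1 (α : ℝ) (Abar : Matrix (Fin d) (Fin d) ℝ)
    (G : Z → Matrix (Fin d) (Fin d) ℝ) (eps : Z → EuclideanSpace ℝ (Fin d)) (w : ℕ → Z) :
    ℕ → EuclideanSpace ℝ (Fin d)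
  | 0 => 0
  | n + 1 => act (1 - α • Abar) (J1 α Abar G eps w n)
      - α • act (G (w (n + 1))) (J0 α Abar eps w n)

variable [MeasurableSpace Z]

theorem measurable_act {Y : Type*} [MeasurableSpace Y] {M : Y → Matrix (Fin d) (Fin d) ℝ}
    (hM : ∀ i j, Measurable fun y => M y i j) {x : Y → EuclideanSpace ℝ (Fin d)}
    (hx : Measurable x) : Measurable fun y => act (M y) (x y) := by
  have h : Measurable fun y => (M y).mulVec (x y).ofLp := by
    refine measurable_pi_lambda _ fun i => ?_
    simp only [Matrix.mulVec, dotProduct]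
    refine Finset.measurable_sum _ fun j _ => (hM i j).mul ?_
    fun_prop
  have e : (fun y => act (M y) (x y)) = fun y => WithLp.toLp 2 ((M y).mulVec (x y).ofLp) := by
    funext y
    rw [← Matrix.toEuclideanCLM_toLp]
  rw [e]
  exact (WithLp.measurable_toLp 2 _).comp h

theorem measurable_tildeA {A : Z → Matrix (Fin d) (Fin d) ℝ}
    (hA : ∀ i j, Measurable fun z => A z i j) (Abar : Matrix (Fin d) (Fin d) ℝ) :
    ∀ i j, Measurable fun z => tildeA A Abar z i j :=
  fun i j => by
    have h : (fun z => tildeA A Abar z i j) = fun z => A z i j - Abar i j := rfl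
    rw [h]
    exact (hA i j).sub_const (Abar i j)

theorem measurable_noise {A : Z → Matrix (Fin d) (Fin d) ℝ}
    (hA : ∀ i j, Measurable fun z => A z i j) {b : Z → EuclideanSpace ℝ (Fin d)}
    (hb : Measurable b) (Abar : Matrix (Fin d) (Fin d) ℝ)
    (bbar θ : EuclideanSpace ℝ (Fin d)) : Measurable (noise A b Abar bbar θ) :=
  (measurable_act (measurable_tildeA hA Abar) measurable_const).sub (hb.sub_const _)

/-- The deterministic part of a step of the chain `Y_t = (Z_{t+1}, J_t^{(0)}, J_t^{(1)})`: it
sends `Y_t` to `(J_{t+1}^{(0)}, J_{t+1}^{(1)})`. -/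
noncomputable def stepJ (α : ℝ) (Abar : Matrix (Fin d) (Fin d) ℝ)
    (G : Z → Matrix (Fin d) (Fin d) ℝ) (eps : Z → EuclideanSpace ℝ (Fin d))
    (y : Z × EuclideanSpace ℝ (Fin d) × EuclideanSpace ℝ (Fin d)) :
    EuclideanSpace ℝ (Fin d) × EuclideanSpace ℝ (Fin d) :=
  (act (1 - α • Abar) y.2.1 - α • eps y.1,
    act (1 - α • Abar) y.2.2 - α • act (G y.1) y.2.1)

theorem measurable_stepJ (α : ℝ) (Abar : Matrix (Fin d) (Fin d) ℝ)
    {G : Z → Matrix (Fin d) (Fin d) ℝ} (hG : ∀ i j, Measurable fun z => G z i j)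
    {eps : Z → EuclideanSpace ℝ (Fin d)} (heps : Measurable eps) :
    Measurable (stepJ α Abar G eps) := by
  have m1 : Measurable fun y : Z × EuclideanSpace ℝ (Fin d) × EuclideanSpace ℝ (Fin d) => y.2.1 :=
    measurable_fst.comp measurable_snd
  have m2 : Measurable fun y : Z × EuclideanSpace ℝ (Fin d) × EuclideanSpace ℝ (Fin d) => y.2.2 :=
    measurable_snd.comp measurable_snd
  have h1 := measurable_act (M := fun _ => 1 - α • Abar) (fun _ _ => measurable_const) m1
  have h2 := measurable_act (M := fun _ => 1 - α • Abar) (fun _ _ => measurable_const) m2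
  have h3 := measurable_act (M := fun y : Z × EuclideanSpace ℝ (Fin d) × EuclideanSpace ℝ (Fin d) =>
    G y.1) (fun i j => (hG i j).comp measurable_fst) m1
  exact (h1.sub ((heps.comp measurable_fst).const_smul α)).prodMk (h2.sub (h3.const_smul α))

/-- The Markov kernel of `Y_t = (Z_{t+1}, J_t^{(0)}, J_t^{(1)})` on `Z × ℝ^d × ℝ^d`. -/
noncomputable def kernelJ1 (Q : Kernel Z Z) (α : ℝ) (Abar : Matrix (Fin d) (Fin d) ℝ)
    {G : Z → Matrix (Fin d) (Fin d) ℝ} (hG : ∀ i j, Measurable fun z => G z i j)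
    {eps : Z → EuclideanSpace ℝ (Fin d)} (heps : Measurable eps) :
    Kernel (Z × EuclideanSpace ℝ (Fin d) × EuclideanSpace ℝ (Fin d))
      (Z × EuclideanSpace ℝ (Fin d) × EuclideanSpace ℝ (Fin d)) :=
  (Q.comap Prod.fst measurable_fst) ×ₖ
    Kernel.deterministic (stepJ α Abar G eps) (measurable_stepJ α Abar hG heps)

/-- `E[Ã(Z_{∞+k}) ε(Z_∞)]`: the expectation when `Z_∞ ∼ π` and `Z_{∞+k}` has law
`Q^k(Z_∞, ·)` given `Z_∞`. -/
noncomputable def crossMoment (Q : Kernel Z Z) (π : Measure Z)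
    (G : Z → Matrix (Fin d) (Fin d) ℝ) (eps : Z → EuclideanSpace ℝ (Fin d)) (k : ℕ) :
    EuclideanSpace ℝ (Fin d) :=
  ∫ p : Z × Z, act (G p.2) (eps p.1) ∂(π ⊗ₘ (Q ^ k))

/-- `Δ = Ā⁻¹ ∑_{k ≥ 1} E[Ã(Z_{∞+k}) ε(Z_∞)]`. -/
noncomputable def biasCoeff (Q : Kernel Z Z) (π : Measure Z)
    (Abar : Matrix (Fin d) (Fin d) ℝ) (G : Z → Matrix (Fin d) (Fin d) ℝ)
    (eps : Z → EuclideanSpace ℝ (Fin d)) : EuclideanSpace ℝ (Fin d) :=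
  act Abar⁻¹ (∑' k : ℕ, crossMoment Q π G eps (k + 1))

end Model

section StepSize

variable {d : ℕ}

/-- The symmetric positive definite solution `Q` of the Lyapunov equation `Āᵀ Q + Q Ā = I`.
It exists and is unique when `-Ā` is Hurwitz (otherwise the value is arbitrary). -/
noncomputable def lyapunovQ (Abar : Matrix (Fin d) (Fin d) ℝ) : Matrix (Fin d) (Fin d) ℝ :=
  Classical.epsilon fun Q => Q.PosDef ∧ Abar.transpose * Q + Q * Abar = 1

/-- The weighted norm `‖x‖_Q = (xᵀ Q x)^{1/2}`. -/
noncomputable def qNorm (Q : Matrix (Fin d) (Fin d) ℝ) (x : EuclideanSpace ℝ (Fin d)) : ℝ :=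
  √(inner ℝ x (act Q x))

/-- The operator norm `‖M‖_Q = max_{‖x‖_Q = 1} ‖M x‖_Q`. -/
noncomputable def qOpNorm (Q M : Matrix (Fin d) (Fin d) ℝ) : ℝ :=
  sSup {r | ∃ x : EuclideanSpace ℝ (Fin d), qNorm Q x = 1 ∧ r = qNorm Q (act M x)}

/-- `κ_Q = λ_max(Q) / λ_min(Q)`. -/
noncomputable def kappaQ (Q : Matrix (Fin d) (Fin d) ℝ) : ℝ :=
  sSup (spectrum ℝ Q) / sInf (spectrum ℝ Q)

/-- `a = ‖Q‖⁻¹ / 2`. -/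
noncomputable def rateA (Abar : Matrix (Fin d) (Fin d) ℝ) : ℝ := ‖lyapunovQ Abar‖⁻¹ / 2

/-- `α_∞ = (1/2) ‖Ā‖_Q⁻² ‖Q‖⁻¹ ∧ ‖Q‖`. -/
noncomputable def alphaInf (Abar : Matrix (Fin d) (Fin d) ℝ) : ℝ :=
  min ((1 / 2) * (qOpNorm (lyapunovQ Abar) Abar ^ 2)⁻¹ * ‖lyapunovQ Abar‖⁻¹) ‖lyapunovQ Abar‖

/-- The integer `⌈8 κ_Q^{1/2} C_A / a⌉`. -/
noncomputable def blockLen (Abar : Matrix (Fin d) (Fin d) ℝ) (CA : ℝ) : ℕ :=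
  ⌈8 * √(kappaQ (lyapunovQ Abar)) * CA / rateA Abar⌉₊

/-- `α_∞^{(M)} = [α_∞ ∧ κ_Q^{-1/2} C_A⁻¹ ∧ a / (6 e κ_Q C_A)] ⌈8 κ_Q^{1/2} C_A / a⌉⁻¹`. -/
noncomputable def alphaInfM (Abar : Matrix (Fin d) (Fin d) ℝ) (CA : ℝ) : ℝ :=
  min (alphaInf Abar)
      (min ((√(kappaQ (lyapunovQ Abar)))⁻¹ * CA⁻¹)
        (rateA Abar / (6 * Real.exp 1 * kappaQ (lyapunovQ Abar) * CA)))
    * (blockLen Abar CA : ℝ)⁻¹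

/-- `C_Γ = 4 (κ_Q^{1/2} C_A + a/6)² ⌈8 κ_Q^{1/2} C_A / a⌉`. -/
noncomputable def constGamma (Abar : Matrix (Fin d) (Fin d) ℝ) (CA : ℝ) : ℝ :=
  4 * (√(kappaQ (lyapunovQ Abar)) * CA + rateA Abar / 6) ^ 2 * (blockLen Abar CA : ℝ)

/-- `α_{q,∞}^{(M)} = α_∞^{(M)} ∧ c / q` with `c = a / (12 C_Γ)`. -/
noncomputable def alphaQM (Abar : Matrix (Fin d) (Fin d) ℝ) (CA q : ℝ) : ℝ :=
  min (alphaInfM Abar CA) (rateA Abar / (12 * constGamma Abar CA) / q)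

/-- `α_{p,∞}^{(b)} = (α_{p(1 + log d),∞}^{(M)} ∧ 1 / (1 + C_A) ∧ 1 / (a p)) t_mix⁻¹`. -/
noncomputable def alphaPB (Abar : Matrix (Fin d) (Fin d) ℝ) (CA : ℝ) (tmix : ℕ) (p : ℝ) : ℝ :=
  min (alphaQM Abar CA (p * (1 + Real.log d))) (min (1 / (1 + CA)) (1 / (rateA Abar * p)))
    * (tmix : ℝ)⁻¹

end StepSize

end LSA

namespace LSA

/-! ### Solving the Lyapunov equation by a Cayley transform. -/

section Lyapunov

variable {d : ℕ}

/-! Write B = 1 - αĀ. Unrolling the recursions into the past suggests the stationary values J⁽⁰⁾ =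
-α ∑ Bᵏ ε(Z₋ₖ) and J⁽¹⁾ = -α ∑ Bᵏ Ã(Z₋ₖ) J⁽⁰⁾₋ₖ₋₁. The series converge because B is a strict
contraction in the norm given by the Lyapunov matrix (`exists_norm_pow_le`). The infinite past is
produced by running the time-reversed kernel; its law on sequences is invariant under prepending a
forward step (`exists_backward_law`), and its image is the invariant law
(`invariant_map_pastState`). Uniqueness holds because two copies driven by the same chain merge,
while the Z-marginal of every invariant law is π (`kernelJ1_invariant_unique`).

Taking expectations in the stationary recursion, m = E[J⁽¹⁾] satisfies Ā m = α ∑ₖ E[Ã(Zₖ₊₁) Bᵏ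
ε(Z₀)] (`act_integral_pastState`). Along an arbitrary chain, E[J⁽¹⁾ₙ] obeys an affine recursion
whose forcing is a truncation of this series with initial laws tending to π, so it converges to m
(`IsMarkovChain.tendsto_integral_J1`).

Replacing Bᵏ by 1 in the series gives αΔ. The error contains ‖Bᵏ - 1‖ ≤ kαC(1 + αC)ᵏ with C = C_A,
while centering of Ã and mixing give a factor 2(1/4)^⌊(k+1)/t⌋. Since αCt ≤ 1/8, mixing absorbs the
growth and the errors sum to at most 8αC²‖ε‖t² (`norm_tsum_crossMoment_sub_le`). Applying αĀ⁻¹ gives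
the remainder bound, with 8 in place of 12. Contraction of B serves only for convergence; its
constants never enter the estimate. -/

theorem exists_pow_norm_le_of_spectrum_lt_one {E : Type*} [NormedRing E] [NormedAlgebra ℂ E]
    [CompleteSpace E] [Nontrivial E] {C : E} (h : ∀ z ∈ spectrum ℂ C, ‖z‖ < 1) :
    ∃ r : ℝ, 0 ≤ r ∧ r < 1 ∧ ∀ᶠ n : ℕ in atTop, ‖C ^ n‖ ≤ r ^ n := by
  have h1 : spectralRadius ℂ C < ((1 : NNReal) : ℝ≥0∞) :=
    spectrum.spectralRadius_lt_of_forall_lt C fun z hz => by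
      simpa [← NNReal.coe_lt_coe] using h z hz
  obtain ⟨r, hr1, hr2⟩ := ENNReal.lt_iff_exists_nnreal_btwn.1 h1
  refine ⟨r, r.2, by exact_mod_cast hr2, ?_⟩
  -- Gelfand's formula: ‖Cⁿ‖^(1/n) tends to the spectral radius, hence is eventually below r.
  have h2 := spectrum.pow_nnnorm_pow_one_div_tendsto_nhds_spectralRadius C
  filter_upwards [h2.eventually (gt_mem_nhds hr1), eventually_gt_atTop 0] with n hn hn0
  have hn' : (n : ℝ) ≠ 0 := by positivity
  have h3 := ENNReal.rpow_le_rpow hn.le (Nat.cast_nonneg n : (0 : ℝ) ≤ n)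
  rw [← ENNReal.rpow_mul, one_div, inv_mul_cancel₀ hn', ENNReal.rpow_one,
    ENNReal.rpow_natCast] at h3
  have h4 : ‖C ^ n‖₊ ≤ r ^ n := by exact_mod_cast h3
  exact_mod_cast h4

theorem abs_entry_le_norm {𝕜 : Type*} [RCLike 𝕜] (M : Matrix (Fin d) (Fin d) 𝕜) (i j : Fin d) :
    ‖M i j‖ ≤ ‖M‖ := by
  have h := Matrix.l2_opNorm_mulVec M (EuclideanSpace.single j 1)
  rw [PiLp.norm_single, norm_one, mul_one] at h
  refine le_trans ?_ h
  refine le_trans (le_of_eq ?_) (PiLp.norm_apply_le _ i)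
  simp

/-- Powers of a real matrix with complex spectrum in the open unit disk decay geometrically. -/
theorem exists_entry_pow_le {C : Matrix (Fin d) (Fin d) ℝ}
    (h : ∀ z ∈ spectrum ℂ (C.map (algebraMap ℝ ℂ)), ‖z‖ < 1) :
    ∃ r : ℝ, 0 ≤ r ∧ r < 1 ∧ ∀ᶠ n : ℕ in atTop, ∀ i j, |(C ^ n) i j| ≤ r ^ n := by
  rcases isEmpty_or_nonempty (Fin d) with hd | hd
  · exact ⟨0, le_rfl, one_pos, Eventually.of_forall fun n i => hd.elim i⟩
  obtain ⟨r, h0, h1, hr⟩ := exists_pow_norm_le_of_spectrum_lt_one h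
  refine ⟨r, h0, h1, hr.mono fun n hn i j => ?_⟩
  have e : (C.map (algebraMap ℝ ℂ)) ^ n = (C ^ n).map (algebraMap ℝ ℂ) :=
    (map_pow (RingHom.mapMatrix (algebraMap ℝ ℂ)) C n).symm
  have := (abs_entry_le_norm ((C.map (algebraMap ℝ ℂ)) ^ n) i j).trans hn
  rw [e] at this
  simpa using this

theorem summable_stein {C : Matrix (Fin d) (Fin d) ℝ}
    (h : ∀ z ∈ spectrum ℂ (C.map (algebraMap ℝ ℂ)), ‖z‖ < 1) (W : Matrix (Fin d) (Fin d) ℝ) :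
    Summable fun n : ℕ => (C ^ n).transpose * W * C ^ n := by
  obtain ⟨r, h0, h1, hr⟩ := exists_entry_pow_le h
  refine Pi.summable.2 fun i => Pi.summable.2 fun j => ?_
  simp only [Matrix.mul_apply, Matrix.transpose_apply, Finset.sum_mul]
  refine summable_sum fun k _ => summable_sum fun l _ => ?_
  refine summable_of_isBigO_nat (g := fun n => r ^ n) (summable_geometric_of_lt_one h0 h1) ?_
  refine Asymptotics.IsBigO.of_bound |W l k| (hr.mono fun n hn => ?_)
  have h2 : r ^ n ≤ 1 := pow_le_one₀ h0 h1.le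
  have h3 : 0 ≤ r ^ n := pow_nonneg h0 n
  rw [Real.norm_eq_abs, Real.norm_eq_abs, abs_mul, abs_mul, abs_of_nonneg h3]
  calc |(C ^ n) l i| * |W l k| * |(C ^ n) k j| ≤ 1 * |W l k| * r ^ n := by
        gcongr
        · exact (hn l i).trans h2
        · exact hn k j
    _ = _ := by ring

/-- The solution is X = ∑ (Cⁿ)ᵀ W Cⁿ: conjugation by C shifts the series by one term, so the
difference is W. Definiteness comes from the zeroth term, the tail being a limit of positive
semidefinite sums. -/
theorem exists_stein {C : Matrix (Fin d) (Fin d) ℝ}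
    (h : ∀ z ∈ spectrum ℂ (C.map (algebraMap ℝ ℂ)), ‖z‖ < 1) {W : Matrix (Fin d) (Fin d) ℝ}
    (hW : W.PosDef) : ∃ X : Matrix (Fin d) (Fin d) ℝ, X.PosDef ∧
      X - C.transpose * X * C = W := by
  have hs := summable_stein h W
  set f : ℕ → Matrix (Fin d) (Fin d) ℝ := fun n => (C ^ n).transpose * W * C ^ n with hf
  have hstep : ∀ n, f (n + 1) = C.transpose * f n * C := fun n => by
    simp only [hf, pow_succ, Matrix.transpose_mul, Matrix.mul_assoc]
  have hps : ∀ n, (f n).PosSemidef := fun n => by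
    have := hW.posSemidef.conjTranspose_mul_mul_same (C ^ n)
    rwa [Matrix.conjTranspose_eq_transpose_of_trivial] at this
  have hclosed : (∑' n, f (n + 1)).PosSemidef := by
    have hs' := (summable_nat_add_iff 1).2 hs
    refine Matrix.PosSemidef.of_dotProduct_mulVec_nonneg ?_ fun x => ?_
    · have : (∑' n, f (n + 1)).conjTranspose = ∑' n, (f (n + 1)).conjTranspose :=
        Matrix.conjTranspose_tsum
      rw [Matrix.IsHermitian, this]
      exact tsum_congr fun n => (hps (n + 1)).1
    · have hL : Continuous fun M : Matrix (Fin d) (Fin d) ℝ => star x ⬝ᵥ M.mulVec x := by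
        fun_prop
      have := hs'.hasSum.tendsto_sum_nat
      have h2 := (hL.tendsto _).comp this
      refine ge_of_tendsto' h2 fun n => ?_
      exact (Matrix.posSemidef_sum _ fun i _ => hps (i + 1)).dotProduct_mulVec_nonneg x
  have e0 : ∑' n, f n = W + ∑' n, f (n + 1) := by
    rw [hs.tsum_eq_zero_add]
    simp [hf]
  refine ⟨∑' n, f n, ?_, ?_⟩
  · rw [e0]
    exact hW.add_posSemidef hclosed
  · have e1 : ∑' n, f (n + 1) = C.transpose * (∑' n, f n) * C := by
      simp only [hstep]
      rw [← hs.tsum_mul_left, (hs.mul_left _).tsum_mul_right]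
    rw [← e1, e0]
    simp

theorem isUnit_of_isUnit_map {M : Matrix (Fin d) (Fin d) ℝ}
    (h : IsUnit (M.map (algebraMap ℝ ℂ))) : IsUnit M := by
  rw [Matrix.isUnit_iff_isUnit_det] at h ⊢
  have e : (M.map (algebraMap ℝ ℂ)).det = algebraMap ℝ ℂ M.det :=
    (RingHom.map_det (algebraMap ℝ ℂ) M).symm
  rw [e] at h
  rw [isUnit_iff_ne_zero] at h ⊢
  intro h0
  exact h (by simp [h0])

/-- A matrix whose opposite is Hurwitz has a solution of the Lyapunov equation. -/
theorem exists_lyapunov {A : Matrix (Fin d) (Fin d) ℝ} (hA : IsHurwitz (-A)) :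
    ∃ Q : Matrix (Fin d) (Fin d) ℝ, Q.PosDef ∧ A.transpose * Q + Q * A = 1 := by
  -- The Cayley transform (1 - A)(1 + A)⁻¹ sends the eigenvalues of A, all in the open right
  -- half-plane, into the open unit disk, and turns the Lyapunov equation into a Stein equation.
  set A' := A.map (algebraMap ℝ ℂ) with hA'
  have hspec : ∀ z : ℂ, 0 ≤ z.re → IsUnit (algebraMap ℂ (Matrix (Fin d) (Fin d) ℂ) z + A') := by
    intro z hz
    by_contra hcon
    have : z ∈ spectrum ℂ ((-A).map (algebraMap ℝ ℂ)) := by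
      rw [spectrum.mem_iff]
      have e : (-A).map (algebraMap ℝ ℂ) = -A' := by
        ext i j; simp [hA']
      rwa [e, sub_neg_eq_add]
    exact absurd (hA z this) (not_lt.2 hz)
  have hU : IsUnit (1 + A) := by
    refine isUnit_of_isUnit_map ?_
    have e : (1 + A).map (algebraMap ℝ ℂ) = algebraMap ℂ _ (1 : ℂ) + A' := by
      rw [map_one]
      exact (map_add (RingHom.mapMatrix (algebraMap ℝ ℂ)) 1 A).trans (by rw [map_one]; rfl)
    rw [e]
    exact hspec 1 (by simp)
  obtain ⟨V, hV1, hV2⟩ : ∃ V, (1 + A) * V = 1 ∧ V * (1 + A) = 1 := by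
    obtain ⟨u, hu⟩ := hU
    exact ⟨↑u⁻¹, by rw [← hu]; simp, by rw [← hu]; simp⟩
  set φ := RingHom.mapMatrix (m := Fin d) (algebraMap ℝ ℂ) with hφ
  have hφA : φ A = A' := rfl
  have hC : ∀ z ∈ spectrum ℂ (((1 - A) * V).map (algebraMap ℝ ℂ)), ‖z‖ < 1 := by
    intro z hz
    by_contra hcon
    rw [not_lt] at hcon
    have e1 : (((1 - A) * V).map (algebraMap ℝ ℂ)) = (1 - A') * φ V := by
      rw [show ((1 - A) * V).map (algebraMap ℝ ℂ) = φ ((1 - A) * V) from rfl, map_mul, map_sub,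
        map_one, hφA]
    have e2 : (1 + A') * φ V = 1 := by
      rw [← hφA, ← map_one φ, ← map_add, ← map_mul, hV1]
    have e3 : φ V * (1 + A') = 1 := by
      rw [← hφA, ← map_one φ, ← map_add, ← map_mul, hV2]
    have hVu : IsUnit (φ V) := ⟨⟨φ V, 1 + A', e3, e2⟩, rfl⟩
    have e4 : algebraMap ℂ (Matrix (Fin d) (Fin d) ℂ) z - (((1 - A) * V).map (algebraMap ℝ ℂ))
        = (algebraMap ℂ _ (z - 1) + (z + 1) • A') * φ V := by
      rw [e1]
      have : algebraMap ℂ (Matrix (Fin d) (Fin d) ℂ) z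
          = algebraMap ℂ (Matrix (Fin d) (Fin d) ℂ) z * ((1 + A') * φ V) := by
        rw [e2, mul_one]
      rw [this, ← mul_assoc, ← sub_mul]
      congr 1
      simp only [Algebra.algebraMap_eq_smul_one, mul_add, smul_mul_assoc, one_mul, sub_smul,
        add_smul, one_smul]
      abel
    refine hz ?_
    rw [spectrum.mem_resolventSet_iff, e4]
    refine IsUnit.mul ?_ hVu
    by_cases hz1 : z + 1 = 0
    · rw [hz1, zero_smul, add_zero]
      have : z - 1 ≠ 0 := fun h => by
        have : (2 : ℂ) = 0 := by linear_combination hz1 - h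
        norm_num at this
      exact (IsUnit.mk0 _ this).map _
    -- The real part of (z - 1)/(z + 1) is (|z|² - 1)/|z + 1|², nonnegative when |z| ≥ 1, so `hspec`
    -- applies to this scalar.
    · have e5 : algebraMap ℂ (Matrix (Fin d) (Fin d) ℂ) (z - 1) + (z + 1) • A'
          = algebraMap ℂ _ (z + 1) * (algebraMap ℂ _ ((z - 1) / (z + 1)) + A') := by
        rw [mul_add, ← map_mul, mul_div_cancel₀ _ hz1, ← Algebra.smul_def]
      rw [e5]
      refine ((IsUnit.mk0 _ hz1).map _).mul (hspec _ ?_)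
      rw [Complex.div_re, ← add_div]
      refine div_nonneg ?_ (Complex.normSq_nonneg _)
      have : 1 ≤ z.re * z.re + z.im * z.im := by
        rw [← Complex.normSq_apply, ← Complex.sq_norm]
        nlinarith
      simp only [Complex.sub_re, Complex.add_re, Complex.one_re, Complex.sub_im, Complex.add_im,
        Complex.one_im]
      nlinarith
  have hW : (V.transpose * V).PosDef := by
    have hinj : Function.Injective V.mulVec :=
      Matrix.mulVec_injective_iff_isUnit.2 ⟨⟨V, 1 + A, hV2, hV1⟩, rfl⟩
    have := Matrix.PosDef.conjTranspose_mul_self V hinj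
    rwa [Matrix.conjTranspose_eq_transpose_of_trivial] at this
  obtain ⟨X, hX, hXe⟩ := exists_stein hC hW
  have hVt : (1 + A).transpose * V.transpose = 1 := by
    rw [← Matrix.transpose_mul, hV2, Matrix.transpose_one]
  have h1 : (1 + A).transpose * (X - ((1 - A) * V).transpose * X * ((1 - A) * V)) * (1 + A)
      = 1 := by
    rw [hXe]
    calc (1 + A).transpose * (V.transpose * V) * (1 + A)
        = ((1 + A).transpose * V.transpose) * (V * (1 + A)) := by noncomm_ring
      _ = 1 := by rw [hVt, hV2, mul_one]
  have h2 : (1 + A).transpose * (X - ((1 - A) * V).transpose * X * ((1 - A) * V)) * (1 + A)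
      = (1 + A).transpose * X * (1 + A) - (1 - A).transpose * X * (1 - A) := by
    rw [Matrix.transpose_mul]
    calc _ = (1 + A).transpose * X * (1 + A) - ((1 + A).transpose * V.transpose)
          * (1 - A).transpose * X * (1 - A) * (V * (1 + A)) := by noncomm_ring
      _ = _ := by rw [hVt, hV2, mul_one, one_mul]
  -- (1 + A)ᵀX(1 + A) - (1 - A)ᵀX(1 - A) = 2(AᵀX + XA), whence the factor 2 in the witness.
  have h3 : A.transpose * ((2 : ℝ) • X) + ((2 : ℝ) • X) * A = 1 := by
    rw [← h1, h2, Matrix.transpose_add, Matrix.transpose_sub, Matrix.transpose_one, two_smul]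
    noncomm_ring
  exact ⟨(2 : ℝ) • X, hX.smul two_pos, h3⟩

/-- Uniqueness is not needed: only these two properties of the chosen solution are used. -/
theorem lyapunovQ_spec {A : Matrix (Fin d) (Fin d) ℝ} (hA : IsHurwitz (-A)) :
    (lyapunovQ A).PosDef ∧ A.transpose * lyapunovQ A + lyapunovQ A * A = 1 :=
  Classical.epsilon_spec (exists_lyapunov hA)

end Lyapunov

/-! ### Stability of 1 - αĀ and consequences of the step size threshold. -/

section StepSize

variable {d : ℕ}

theorem norm_act_le (M : Matrix (Fin d) (Fin d) ℝ) (x : EuclideanSpace ℝ (Fin d)) :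
    ‖act M x‖ ≤ ‖M‖ * ‖x‖ := by
  rw [Matrix.cstar_norm_def]
  exact ContinuousLinearMap.le_opNorm _ x

theorem norm_le_of_norm_act_le {M : Matrix (Fin d) (Fin d) ℝ} {C : ℝ} (hC : 0 ≤ C)
    (h : ∀ x, ‖act M x‖ ≤ C * ‖x‖) : ‖M‖ ≤ C := by
  rw [Matrix.cstar_norm_def]
  exact ContinuousLinearMap.opNorm_le_bound _ hC h

theorem act_mul (M N : Matrix (Fin d) (Fin d) ℝ) (x : EuclideanSpace ℝ (Fin d)) :
    act (M * N) x = act M (act N x) := by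
  simp [act]

theorem act_one (x : EuclideanSpace ℝ (Fin d)) : act 1 x = x := by
  simp [act]

theorem act_sub (M N : Matrix (Fin d) (Fin d) ℝ) (x : EuclideanSpace ℝ (Fin d)) :
    act (M - N) x = act M x - act N x := by
  simp [act]

theorem act_add (M N : Matrix (Fin d) (Fin d) ℝ) (x : EuclideanSpace ℝ (Fin d)) :
    act (M + N) x = act M x + act N x := by
  simp [act]

theorem act_smul (c : ℝ) (M : Matrix (Fin d) (Fin d) ℝ) (x : EuclideanSpace ℝ (Fin d)) :
    act (c • M) x = c • act M x := by
  simp [act]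

theorem act_vec_sub (M : Matrix (Fin d) (Fin d) ℝ) (x y : EuclideanSpace ℝ (Fin d)) :
    act M (x - y) = act M x - act M y :=
  map_sub _ _ _

theorem act_vec_smul (c : ℝ) (M : Matrix (Fin d) (Fin d) ℝ) (x : EuclideanSpace ℝ (Fin d)) :
    act M (c • x) = c • act M x :=
  map_smul _ _ _

theorem inner_act_left (M : Matrix (Fin d) (Fin d) ℝ) (x y : EuclideanSpace ℝ (Fin d)) :
    inner ℝ (act M x) y = inner ℝ x (act M.transpose y) := by
  have h : Matrix.toEuclideanCLM (n := Fin d) (𝕜 := ℝ) M.transpose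
      = ContinuousLinearMap.adjoint (Matrix.toEuclideanCLM (n := Fin d) (𝕜 := ℝ) M) := by
    rw [← Matrix.conjTranspose_eq_transpose_of_trivial, ← Matrix.star_eq_conjTranspose]
    exact map_star (Matrix.toEuclideanCLM (n := Fin d) (𝕜 := ℝ)) M
  rw [act, act, h, ContinuousLinearMap.adjoint_inner_right]

theorem nontrivial_matrix (hd : 1 ≤ d) : Nontrivial (Matrix (Fin d) (Fin d) ℝ) := by
  have : Nonempty (Fin d) := ⟨⟨0, hd⟩⟩
  infer_instance

section PosDef

variable {Q : Matrix (Fin d) (Fin d) ℝ}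

open scoped MatrixOrder in
-- Q = SᵀS with S invertible, so xᵀQx = ‖Sx‖² and m can be ‖S⁻¹‖².
theorem PosDef.exists_norm_sq_le (hQ : Q.PosDef) :
    ∃ m : ℝ, 0 ≤ m ∧ ∀ x, ‖x‖ ^ 2 ≤ m * inner ℝ x (act Q x) := by
  obtain ⟨S, hS⟩ := CStarAlgebra.nonneg_iff_eq_star_mul_self.mp hQ.posSemidef.nonneg
  have hSu : IsUnit S.det := by
    have h1 := (Matrix.isUnit_iff_isUnit_det _).1 hQ.isUnit
    rw [hS, Matrix.det_mul] at h1
    exact isUnit_of_mul_isUnit_right h1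
  refine ⟨‖S⁻¹‖ ^ 2, by positivity, fun x => ?_⟩
  have h2 : inner ℝ x (act Q x) = ‖act S x‖ ^ 2 := by
    rw [← real_inner_self_eq_norm_sq, inner_act_left, ← act_mul, hS, Matrix.star_eq_conjTranspose,
      Matrix.conjTranspose_eq_transpose_of_trivial]
  rw [h2, ← mul_pow]
  gcongr
  calc ‖x‖ = ‖act S⁻¹ (act S x)‖ := by rw [← act_mul, Matrix.nonsing_inv_mul _ hSu, act_one]
    _ ≤ _ := norm_act_le _ _

theorem PosDef.inner_nonneg (hQ : Q.PosDef) (x : EuclideanSpace ℝ (Fin d)) :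
    0 ≤ inner ℝ x (act Q x) := by
  rw [Matrix.inner_toEuclideanCLM]
  simpa using hQ.posSemidef.dotProduct_mulVec_nonneg x.ofLp

theorem inner_act_le (Q : Matrix (Fin d) (Fin d) ℝ) (x : EuclideanSpace ℝ (Fin d)) :
    inner ℝ x (act Q x) ≤ ‖Q‖ * ‖x‖ ^ 2 := by
  calc inner ℝ x (act Q x) ≤ ‖x‖ * ‖act Q x‖ := real_inner_le_norm _ _
    _ ≤ ‖x‖ * (‖Q‖ * ‖x‖) := by gcongr; exact norm_act_le _ _
    _ = _ := by ring

theorem PosDef.inner_act_act_le (hQ : Q.PosDef) (M : Matrix (Fin d) (Fin d) ℝ)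
    (x : EuclideanSpace ℝ (Fin d)) :
    inner ℝ (act M x) (act Q (act M x)) ≤ qOpNorm Q M ^ 2 * inner ℝ x (act Q x) := by
  obtain ⟨m, hm0, hm⟩ := PosDef.exists_norm_sq_le hQ
  have hsq : ∀ y, qNorm Q y ^ 2 = inner ℝ y (act Q y) := fun y =>
    Real.sq_sqrt (PosDef.inner_nonneg hQ y)
  -- The supremum of an unbounded set of reals is 0 by convention, so `qOpNorm` controls anything
  -- only once this set is known to be bounded.
  have hbdd : BddAbove {r | ∃ x : EuclideanSpace ℝ (Fin d), qNorm Q x = 1 ∧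
      r = qNorm Q (act M x)} := by
    refine ⟨√(‖Q‖ * ‖M‖ ^ 2 * m), ?_⟩
    rintro r ⟨y, hy, rfl⟩
    refine Real.sqrt_le_sqrt ?_
    have h1 : ‖y‖ ^ 2 ≤ m := by
      have := hm y
      rwa [← hsq, hy, one_pow, mul_one] at this
    calc _ ≤ ‖Q‖ * ‖act M y‖ ^ 2 := inner_act_le Q _
      _ ≤ ‖Q‖ * (‖M‖ * ‖y‖) ^ 2 := by gcongr; exact norm_act_le _ _
      _ = ‖Q‖ * ‖M‖ ^ 2 * ‖y‖ ^ 2 := by ring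
      _ ≤ _ := by gcongr
  rw [← hsq, ← hsq, ← mul_pow]
  by_cases h0 : qNorm Q x = 0
  · have hx : x = 0 := by
      have := hm x
      rw [← hsq, h0, zero_pow two_ne_zero, mul_zero] at this
      have := pow_eq_zero_iff two_ne_zero |>.1 (le_antisymm this (sq_nonneg _))
      simpa using this
    simp [hx, qNorm]
  · have hpos : 0 < qNorm Q x := lt_of_le_of_ne (Real.sqrt_nonneg _) (Ne.symm h0)
    have hhom : ∀ (c : ℝ), 0 ≤ c → ∀ y, qNorm Q (c • y) = c * qNorm Q y := fun c hc y => by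
      rw [qNorm, act_vec_smul, inner_smul_left, inner_smul_right, conj_trivial, ← mul_assoc,
        ← sq, Real.sqrt_mul (sq_nonneg c), Real.sqrt_sq hc, qNorm]
    have hle : qNorm Q (act M ((qNorm Q x)⁻¹ • x)) ≤ qOpNorm Q M := by
      refine le_csSup hbdd ⟨(qNorm Q x)⁻¹ • x, ?_, rfl⟩
      rw [hhom _ (inv_nonneg.2 hpos.le), inv_mul_cancel₀ h0]
    rw [act_vec_smul, hhom _ (inv_nonneg.2 hpos.le)] at hle
    have h3 : qNorm Q (act M x) ≤ qOpNorm Q M * qNorm Q x := by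
      rwa [inv_mul_le_iff₀ hpos, mul_comm] at hle
    have h4 : 0 ≤ qNorm Q (act M x) := Real.sqrt_nonneg _
    gcongr

theorem PosDef.one_le_kappaQ (hd : 1 ≤ d) (hQ : Q.PosDef) : 1 ≤ kappaQ Q := by
  have : Nonempty (Fin d) := ⟨⟨0, hd⟩⟩
  have hfin : (spectrum ℝ Q).Finite := Matrix.finite_real_spectrum
  have hr := hQ.isHermitian.spectrum_real_eq_range_eigenvalues
  have hne : (spectrum ℝ Q).Nonempty := by
    rw [hr]; exact Set.range_nonempty _
  have hpos : 0 < sInf (spectrum ℝ Q) := by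
    have := hne.csInf_mem hfin
    rw [hr] at this ⊢
    obtain ⟨i, hi⟩ := this
    rw [← hi]
    exact hQ.eigenvalues_pos i
  rw [kappaQ, le_div_iff₀ hpos, one_mul]
  exact csInf_le_csSup hne hfin.bddBelow hfin.bddAbove

end PosDef

variable {A : Matrix (Fin d) (Fin d) ℝ}

theorem norm_lyapunovQ_pos (hd : 1 ≤ d) (hA : IsHurwitz (-A)) : 0 < ‖lyapunovQ A‖ := by
  have := nontrivial_matrix hd
  rw [norm_pos_iff]
  intro h0
  have := (lyapunovQ_spec hA).2
  simp [h0] at this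

theorem rateA_pos (hd : 1 ≤ d) (hA : IsHurwitz (-A)) : 0 < rateA A := by
  have := norm_lyapunovQ_pos hd hA
  unfold rateA
  positivity

/-- Norms in the Lyapunov equation give 1 ≤ 2‖A‖‖Q‖. This is what makes the block length at least 8.
-/
theorem rateA_le_norm (hd : 1 ≤ d) (hA : IsHurwitz (-A)) : rateA A ≤ ‖A‖ := by
  have := nontrivial_matrix hd
  have hpos := norm_lyapunovQ_pos hd hA
  have h1 : ‖(1 : Matrix (Fin d) (Fin d) ℝ)‖ = 1 := CStarRing.norm_one
  have h2 : ‖A.transpose‖ = ‖A‖ := by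
    rw [← Matrix.conjTranspose_eq_transpose_of_trivial, Matrix.l2_opNorm_conjTranspose]
  have h3 : 1 ≤ 2 * ‖A‖ * ‖lyapunovQ A‖ := by
    rw [← h1, ← (lyapunovQ_spec hA).2]
    calc _ ≤ ‖A.transpose‖ * ‖lyapunovQ A‖ + ‖lyapunovQ A‖ * ‖A‖ :=
          (norm_add_le _ _).trans (add_le_add (norm_mul_le _ _) (norm_mul_le _ _))
      _ = _ := by rw [h2]; ring
  rw [rateA, div_le_iff₀ two_pos, inv_le_iff_one_le_mul₀ hpos]
  linarith

theorem isUnit_of_isHurwitz_neg (hA : IsHurwitz (-A)) : IsUnit A.det := by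
  rw [← Matrix.isUnit_iff_isUnit_det]
  refine isUnit_of_isUnit_map ?_
  by_contra hcon
  have h0 : (0 : ℂ) ∈ spectrum ℂ ((-A).map (algebraMap ℝ ℂ)) := by
    rw [spectrum.zero_mem_iff]
    have e : (-A).map (algebraMap ℝ ℂ) = -A.map (algebraMap ℝ ℂ) := by
      ext i j; simp
    rwa [e, IsUnit.neg_iff]
  exact lt_irrefl _ (hA 0 h0)

/-- Below the threshold `alphaInf`, the powers of `1 - α • A` decay geometrically. -/
theorem exists_norm_pow_le (hd : 1 ≤ d) (hA : IsHurwitz (-A)) {α : ℝ} (hα : 0 < α)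
    (hα' : α ≤ alphaInf A) :
    ∃ c r : ℝ, 0 ≤ c ∧ 0 ≤ r ∧ r < 1 ∧ ∀ n : ℕ, ‖(1 - α • A) ^ n‖ ≤ c * r ^ n := by
  obtain ⟨hQ, hL⟩ := lyapunovQ_spec hA
  have hpos := norm_lyapunovQ_pos hd hA
  have hα1 := hα'.trans (min_le_left _ _)
  have hα2 := hα'.trans (min_le_right _ _)
  set Q := lyapunovQ A
  set K := qOpNorm Q A
  have hK : α * K ^ 2 ≤ 1 / (2 * ‖Q‖) := by
    rcases eq_or_ne (K ^ 2) 0 with h0 | h0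
    · rw [h0, mul_zero]; positivity
    · have : 0 < K ^ 2 := lt_of_le_of_ne (sq_nonneg _) (Ne.symm h0)
      calc α * K ^ 2 ≤ 1 / 2 * (K ^ 2)⁻¹ * ‖Q‖⁻¹ * K ^ 2 := by gcongr
        _ = 1 / (2 * ‖Q‖) * ((K ^ 2)⁻¹ * K ^ 2) := by ring
        _ = _ := by rw [inv_mul_cancel₀ h0, mul_one]
  -- Per-step factor for xᵀQx: the Lyapunov equation gains α/‖Q‖, and by `hK` the quadratic term
  -- loses at most half of it. The bound α ≤ ‖Q‖ keeps ρ nonnegative.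
  set ρ := 1 - α / (2 * ‖Q‖) with hρ
  have hρ0 : 0 ≤ ρ := by
    rw [hρ, sub_nonneg, div_le_one (by positivity)]; linarith
  have hρ1 : ρ < 1 := by
    rw [hρ]; linarith [div_pos hα (by positivity : 0 < 2 * ‖Q‖)]
  have hstep : ∀ x, inner ℝ (act (1 - α • A) x) (act Q (act (1 - α • A) x))
      ≤ ρ * inner ℝ x (act Q x) := fun x => by
    have e1 : inner ℝ (act A x) (act Q x) + inner ℝ x (act Q (act A x)) = ‖x‖ ^ 2 := by
      rw [inner_act_left, ← act_mul, ← act_mul, ← inner_add_right, ← act_add, hL, act_one,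
        real_inner_self_eq_norm_sq]
    have e2 : inner ℝ (act (1 - α • A) x) (act Q (act (1 - α • A) x))
        = inner ℝ x (act Q x) - α * ‖x‖ ^ 2
          + α ^ 2 * inner ℝ (act A x) (act Q (act A x)) := by
      rw [← e1, act_sub, act_one, act_smul, act_vec_sub, act_vec_smul, inner_sub_left,
        inner_sub_right,
        inner_sub_right, inner_smul_left, inner_smul_right, inner_smul_left, inner_smul_right]
      simp only [conj_trivial]
      ring
    have h3 := inner_act_le Q x
    have h4 := PosDef.inner_act_act_le hQ A x
    have h5 := PosDef.inner_nonneg hQ x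
    rw [e2]
    have h6 : α / ‖Q‖ * inner ℝ x (act Q x) ≤ α * ‖x‖ ^ 2 := by
      rw [div_mul_eq_mul_div, div_le_iff₀ hpos]
      nlinarith
    have h7 : α ^ 2 * inner ℝ (act A x) (act Q (act A x))
        ≤ α * (1 / (2 * ‖Q‖)) * inner ℝ x (act Q x) := by
      calc _ ≤ α ^ 2 * (K ^ 2 * inner ℝ x (act Q x)) := by gcongr
        _ = α * (α * K ^ 2) * inner ℝ x (act Q x) := by ring
        _ ≤ _ := by gcongr
    have h8 : ρ * inner ℝ x (act Q x) = inner ℝ x (act Q x) - α / ‖Q‖ * inner ℝ x (act Q x)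
        + α * (1 / (2 * ‖Q‖)) * inner ℝ x (act Q x) := by
      rw [hρ]; field_simp; ring
    linarith
  have hiter : ∀ n x, inner ℝ (act ((1 - α • A) ^ n) x) (act Q (act ((1 - α • A) ^ n) x))
      ≤ ρ ^ n * inner ℝ x (act Q x) := fun n x => by
    induction n with
    | zero => simp [act_one]
    | succ n ih =>
      rw [pow_succ', act_mul, pow_succ', mul_assoc]
      exact (hstep _).trans (by gcongr)
  obtain ⟨m, hm0, hm⟩ := PosDef.exists_norm_sq_le hQ
  refine ⟨√(m * ‖Q‖), √ρ, Real.sqrt_nonneg _, Real.sqrt_nonneg _, ?_, fun n => ?_⟩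
  · rw [Real.sqrt_lt' one_pos]; simpa using hρ1
  · refine norm_le_of_norm_act_le (by positivity) fun x => ?_
    refine le_of_sq_le_sq ?_ (by positivity)
    calc ‖act ((1 - α • A) ^ n) x‖ ^ 2 ≤ m * (ρ ^ n * (‖Q‖ * ‖x‖ ^ 2)) :=
          (hm _).trans (by gcongr; exact (hiter n x).trans (by gcongr; exact inner_act_le Q x))
      _ = (√(m * ‖Q‖) * √ρ ^ n * ‖x‖) ^ 2 := by
          rw [mul_pow, mul_pow, Real.sq_sqrt (by positivity), ← pow_mul, mul_comm n 2, pow_mul,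
            Real.sq_sqrt hρ0]
          ring

/-- The only consequences of the threshold that are needed: the first gives stability, the second
lets mixing beat the growth (1 + αC_A)ᵏ. Since a ≤ ‖A‖ ≤ C_A and κ_Q ≥ 1, the block length is at
least 8, whence the 1/8. -/
theorem stepSize_bounds (hd : 1 ≤ d) (hA : IsHurwitz (-A)) {CA : ℝ} (hCA : ‖A‖ ≤ CA) {t : ℕ}
    (ht : 1 ≤ t) {α : ℝ} (hα : 0 < α) (hα' : α < alphaPB A CA t 2) :
    α ≤ alphaInf A ∧ α * CA * t ≤ 1 / 8 := by
  have ha := rateA_pos hd hA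
  have haC : rateA A ≤ CA := (rateA_le_norm hd hA).trans hCA
  have hC : 0 < CA := ha.trans_le haC
  have hκ := PosDef.one_le_kappaQ hd (lyapunovQ_spec hA).1
  have hκ' : 1 ≤ √(kappaQ (lyapunovQ A)) := Real.one_le_sqrt.2 hκ
  have ht0 : (1 : ℝ) ≤ t := by exact_mod_cast ht
  have hN : (8 : ℝ) ≤ blockLen A CA := by
    refine le_trans ?_ (Nat.le_ceil _)
    rw [le_div_iff₀ ha]
    nlinarith
  rw [alphaPB, lt_mul_inv_iff₀ (by positivity)] at hα'
  have h1 : α * t < alphaInfM A CA := (hα'.trans_le (min_le_left _ _)).trans_le (min_le_left _ _)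
  rw [alphaInfM, lt_mul_inv_iff₀ (by positivity)] at h1
  have h2 := h1.trans_le (min_le_left _ _)
  have h3 := (h1.trans_le (min_le_right _ _)).trans_le (min_le_left _ _)
  have h4 : (√(kappaQ (lyapunovQ A)))⁻¹ * CA⁻¹ ≤ CA⁻¹ :=
    mul_le_of_le_one_left (by positivity) (inv_le_one_of_one_le₀ hκ')
  have h5 : α * t * blockLen A CA * CA ≤ 1 := by
    have := h3.le.trans h4
    rwa [← one_div, le_div_iff₀ hC] at this
  constructor
  · refine le_trans ?_ h2.le
    have : 1 ≤ (t : ℝ) * blockLen A CA := by nlinarith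
    nlinarith
  · have : 0 ≤ α * t * CA := by positivity
    nlinarith

end StepSize

/-! ### Consequences of the mixing time for integrals and correlations. -/

section Mixing

theorem norm_integral_sub_le_of_forall {Y E : Type*} [MeasurableSpace Y] {μ : Measure Y}
    [IsProbabilityMeasure μ] [NormedAddCommGroup E] [NormedSpace ℝ E] [CompleteSpace E] {f : Y → E}
    (hf : Integrable f μ) {c : E} {C : ℝ} (h : ∀ y, ‖f y - c‖ ≤ C) : ‖∫ y, f y ∂μ - c‖ ≤ C := by
  have e : ∫ y, f y ∂μ - c = ∫ y, (f y - c) ∂μ := by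
    rw [integral_sub hf (integrable_const c)]; simp
  rw [e]
  refine (norm_integral_le_of_norm_le_const (Eventually.of_forall h)).trans ?_
  simp

theorem norm_integral_le_of_forall {Y E : Type*} [MeasurableSpace Y] {μ : Measure Y}
    [IsProbabilityMeasure μ] [NormedAddCommGroup E] [NormedSpace ℝ E] {f : Y → E}
    {C : ℝ} (h : ∀ y, ‖f y‖ ≤ C) : ‖∫ y, f y ∂μ‖ ≤ C := by
  refine (norm_integral_le_of_norm_le_const (Eventually.of_forall h)).trans ?_
  simp

theorem integrable_of_bound {Y E : Type*} [MeasurableSpace Y] {μ : Measure Y} [IsFiniteMeasure μ]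
    [NormedAddCommGroup E] {f : Y → E} (hf : StronglyMeasurable f) {C : ℝ} (h : ∀ y, ‖f y‖ ≤ C) :
    Integrable f μ :=
  Integrable.of_bound hf.aestronglyMeasurable C (Eventually.of_forall h)

variable {Z : Type*} [MeasurableSpace Z]
  {E : Type*} [NormedAddCommGroup E] [NormedSpace ℝ E]

/-- By the Jordan decomposition, μ plus the negative part equals ν plus the positive part, so the
difference of integrals lives on the two parts, whose total mass is `tvNorm`. -/
theorem norm_integral_sub_integral_le_tvNorm (μ ν : Measure Z) [IsFiniteMeasure μ]
    [IsFiniteMeasure ν] {g : Z → E} (hg : StronglyMeasurable g) {C : ℝ} (hC : ∀ z, ‖g z‖ ≤ C) :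
    ‖∫ z, g z ∂μ - ∫ z, g z ∂ν‖ ≤ C * (tvNorm μ ν).toReal := by
  set j := (μ.toSignedMeasure - ν.toSignedMeasure).toJordanDecomposition with hj
  have h1 : μ + j.negPart = ν + j.posPart := by
    rw [← Measure.toSignedMeasure_eq_toSignedMeasure_iff, Measure.toSignedMeasure_add,
      Measure.toSignedMeasure_add]
    have h2 : j.posPart.toSignedMeasure - j.negPart.toSignedMeasure
        = μ.toSignedMeasure - ν.toSignedMeasure :=
      SignedMeasure.toSignedMeasure_toJordanDecomposition _
    rw [add_comm ν.toSignedMeasure, ← sub_eq_sub_iff_add_eq_add, h2]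
  have hi : ∀ (ρ : Measure Z) [IsFiniteMeasure ρ], Integrable g ρ := fun ρ _ =>
    integrable_of_bound hg hC
  have h3 : ∫ z, g z ∂μ - ∫ z, g z ∂ν = ∫ z, g z ∂j.posPart - ∫ z, g z ∂j.negPart := by
    rw [sub_eq_sub_iff_add_eq_add, ← integral_add_measure (hi _) (hi _), h1,
      integral_add_measure (hi _) (hi _), add_comm]
  have h4 : (tvNorm μ ν).toReal = j.posPart.real Set.univ + j.negPart.real Set.univ := by
    rw [← measureReal_add_apply]
    rfl
  rw [h3, h4, mul_add]
  exact (norm_sub_le _ _).trans (add_le_add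
    (norm_integral_le_of_norm_le_const (Eventually.of_forall hC))
    (norm_integral_le_of_norm_le_const (Eventually.of_forall hC)))

theorem integral_comp_measure {Y : Type*} [MeasurableSpace Y] (κ : Kernel Z Y) [IsMarkovKernel κ]
    (μ : Measure Z) [IsFiniteMeasure μ] {g : Y → E} (hg : StronglyMeasurable g) {C : ℝ}
    (hC : ∀ z, ‖g z‖ ≤ C) :
    ∫ y, g y ∂(κ ∘ₘ μ) = ∫ z, ∫ y, g y ∂(κ z) ∂μ := by
  rw [← Measure.snd_compProd, Measure.snd, integral_map measurable_snd.aemeasurable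
    hg.aestronglyMeasurable, Measure.integral_compProd]
  exact integrable_of_bound (hg.comp_measurable measurable_snd) fun p => hC p.2

variable {Q : Kernel Z Z}

theorem invariant_pow {π : Measure Z} (hπ : Q.Invariant π) (k : ℕ) : (Q ^ k).Invariant π := by
  induction k with
  | zero => exact Measure.id_comp
  | succ k ih => rw [pow_succ]; exact ih.comp hπ

variable [IsMarkovKernel Q]

theorem HasMixingTime.tvNorm_le {t : ℕ} (h : HasMixingTime Q t) {k : ℕ} (hk : 1 ≤ k) (z z' : Z) :
    (tvNorm ((Q ^ k) z) ((Q ^ k) z')).toReal ≤ 2 * (1 / 4) ^ (k / t) := by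
  have h1 : tvNorm ((Q ^ k) z) ((Q ^ k) z') / 2 ≤ (1 / 4 : ℝ≥0∞) ^ (k / t) :=
    (le_iSup₂ (f := fun z z' => tvNorm ((Q ^ k) z) ((Q ^ k) z') / 2) z z').trans (h k hk)
  have h2 := ENNReal.toReal_mono (by simp) h1
  simp only [ENNReal.toReal_div, ENNReal.toReal_pow, ENNReal.toReal_one, ENNReal.toReal_ofNat] at h2
  linarith

variable [CompleteSpace E] {π : Measure Z} [IsProbabilityMeasure π] {t : ℕ}

/-- Invariance writes π as an average of the laws Qᵏ(z', ·), so the bound between pairs of points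
applies. The 2 undoes the 1/2 in `dobrushin`. -/
theorem norm_integral_pow_sub_le (hπ : Q.Invariant π) (h : HasMixingTime Q t) {g : Z → E}
    (hg : StronglyMeasurable g) {C : ℝ} (hC : ∀ z, ‖g z‖ ≤ C) {k : ℕ} (hk : 1 ≤ k) (z : Z) :
    ‖∫ y, g y ∂((Q ^ k) z) - ∫ y, g y ∂π‖ ≤ C * (2 * (1 / 4) ^ (k / t)) := by
  have hC0 : 0 ≤ C := (norm_nonneg _).trans (hC z)
  have e : ∫ y, g y ∂π = ∫ z', ∫ y, g y ∂((Q ^ k) z') ∂π := by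
    rw [← integral_comp_measure (Q ^ k) π hg hC]
    exact congrArg (fun ρ => ∫ y, g y ∂ρ) (invariant_pow hπ k).def.symm
  rw [norm_sub_rev, e]
  refine norm_integral_sub_le_of_forall
    (integrable_of_bound hg.integral_kernel fun z' => norm_integral_le_of_forall hC) fun z' => ?_
  refine (norm_integral_sub_integral_le_tvNorm _ _ hg hC).trans ?_
  gcongr
  exact h.tvNorm_le hk z' z

theorem norm_integral_comp_pow_sub_le (hπ : Q.Invariant π) (h : HasMixingTime Q t) {g : Z → E}
    (hg : StronglyMeasurable g) {C : ℝ} (hC : ∀ z, ‖g z‖ ≤ C) {k : ℕ} (hk : 1 ≤ k)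
    (μ : Measure Z) [IsProbabilityMeasure μ] :
    ‖∫ y, g y ∂((Q ^ k) ∘ₘ μ) - ∫ y, g y ∂π‖ ≤ C * (2 * (1 / 4) ^ (k / t)) := by
  rw [integral_comp_measure (Q ^ k) μ hg hC]
  exact norm_integral_sub_le_of_forall
    (integrable_of_bound hg.integral_kernel fun z' => norm_integral_le_of_forall hC)
    fun z => norm_integral_pow_sub_le hπ h hg hC hk z

theorem tendsto_quarter_pow_div (ht : 1 ≤ t) :
    Tendsto (fun k : ℕ => (1 / 4 : ℝ) ^ (k / t)) atTop (𝓝 0) :=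
  (tendsto_pow_atTop_nhds_zero_of_lt_one (by norm_num) (by norm_num)).comp
    (Nat.tendsto_div_const_atTop (by omega))

theorem tendsto_integral_comp_pow (hπ : Q.Invariant π) (ht : 1 ≤ t) (h : HasMixingTime Q t)
    {g : Z → E} (hg : StronglyMeasurable g) {C : ℝ} (hC : ∀ z, ‖g z‖ ≤ C)
    (μ : Measure Z) [IsProbabilityMeasure μ] :
    Tendsto (fun k : ℕ => ∫ y, g y ∂((Q ^ k) ∘ₘ μ)) atTop (𝓝 (∫ y, g y ∂π)) := by
  rw [tendsto_iff_norm_sub_tendsto_zero]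
  have h0 : Tendsto (fun k : ℕ => C * (2 * (1 / 4 : ℝ) ^ (k / t))) atTop (𝓝 0) := by
    simpa using ((tendsto_quarter_pow_div ht).const_mul 2).const_mul C
  refine squeeze_zero' (Eventually.of_forall fun _ => norm_nonneg _) ?_ h0
  filter_upwards [eventually_ge_atTop 1] with k hk
  exact norm_integral_comp_pow_sub_le hπ h hg hC hk μ

/-- A kernel with a finite mixing time has at most one invariant probability measure. -/
theorem invariant_unique (hπ : Q.Invariant π) (ht : 1 ≤ t) (h : HasMixingTime Q t)
    {μ : Measure Z} [IsProbabilityMeasure μ] (hμ : Q.Invariant μ) : μ = π := by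
  refine Measure.ext fun s hs => ?_
  have hg : StronglyMeasurable (s.indicator fun _ => (1 : ℝ)) :=
    stronglyMeasurable_const.indicator hs
  have hC : ∀ z, ‖s.indicator (fun _ => (1 : ℝ)) z‖ ≤ 1 := fun z =>
    (norm_indicator_le_norm_self _ _).trans (by simp)
  have h1 := tendsto_integral_comp_pow hπ ht h hg hC μ
  have h2 : ∀ k : ℕ, (Q ^ k) ∘ₘ μ = μ := fun k => invariant_pow hμ k
  simp only [h2] at h1
  have h3 := tendsto_nhds_unique h1 tendsto_const_nhds
  rw [integral_indicator_const _ hs, integral_indicator_const _ hs] at h3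
  simpa [measureReal_def, ENNReal.toReal_eq_toReal_iff'] using h3.symm

/-! ### Decay and convergence of the cross moments. -/

section CrossMoment

variable {d : ℕ} {G : Z → Matrix (Fin d) (Fin d) ℝ} {e : Z → EuclideanSpace ℝ (Fin d)} {C D : ℝ}

theorem stronglyMeasurable_act_prod (hG : ∀ i j, Measurable fun z => G z i j) (he : Measurable e) :
    StronglyMeasurable fun p : Z × Z => act (G p.2) (e p.1) :=
  (measurable_act (M := fun p : Z × Z => G p.2) (fun i j => (hG i j).comp measurable_snd)
    (he.comp measurable_fst)).stronglyMeasurable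

theorem norm_act_le_of_le {M : Matrix (Fin d) (Fin d) ℝ} {x : EuclideanSpace ℝ (Fin d)}
    (hM : ‖M‖ ≤ C) (hx : ‖x‖ ≤ D) : ‖act M x‖ ≤ C * D := by
  have hC0 : 0 ≤ C := (norm_nonneg M).trans hM
  exact (norm_act_le M x).trans (by gcongr)

theorem crossMoment_eq_integral (hG : ∀ i j, Measurable fun z => G z i j) (he : Measurable e)
    (hGb : ∀ z, ‖G z‖ ≤ C) (heb : ∀ z, ‖e z‖ ≤ D) (μ : Measure Z) [IsProbabilityMeasure μ] (k : ℕ) :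
    crossMoment Q μ G e k = ∫ z, ∫ z', act (G z') (e z) ∂((Q ^ k) z) ∂μ := by
  rw [crossMoment, Measure.integral_compProd]
  exact integrable_of_bound (stronglyMeasurable_act_prod hG he) fun p =>
    norm_act_le_of_le (hGb p.2) (heb p.1)

/-- With the older point z frozen, `e z` is a constant vector against which G averages to 0 under π;
k steps of mixing bring the conditional mean close to that, whatever the law μ of z. -/
theorem norm_crossMoment_le (hπ : Q.Invariant π) (h : HasMixingTime Q t)
    (hG : ∀ i j, Measurable fun z => G z i j) (he : Measurable e)
    (hGb : ∀ z, ‖G z‖ ≤ C) (heb : ∀ z, ‖e z‖ ≤ D) (hG0 : ∀ v, ∫ z, act (G z) v ∂π = 0)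
    (μ : Measure Z) [IsProbabilityMeasure μ] {k : ℕ} (hk : 1 ≤ k) :
    ‖crossMoment Q μ G e k‖ ≤ C * D * (2 * (1 / 4) ^ (k / t)) := by
  rw [crossMoment_eq_integral hG he hGb heb]
  refine norm_integral_le_of_forall fun z => ?_
  have hm : StronglyMeasurable fun z' => act (G z') (e z) :=
    (measurable_act hG measurable_const).stronglyMeasurable
  have h1 := norm_integral_pow_sub_le hπ h hm
    (fun z' => norm_act_le_of_le (hGb z') (heb z)) hk z
  rwa [hG0, sub_zero] at h1

/-- The conditional mean over the k later steps is a bounded measurable function of the older point,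
whose law tends to π. -/
theorem tendsto_crossMoment (hπ : Q.Invariant π) (ht : 1 ≤ t) (h : HasMixingTime Q t)
    (hG : ∀ i j, Measurable fun z => G z i j) (he : Measurable e)
    (hGb : ∀ z, ‖G z‖ ≤ C) (heb : ∀ z, ‖e z‖ ≤ D)
    (μ : Measure Z) [IsProbabilityMeasure μ] (k : ℕ) :
    Tendsto (fun i : ℕ => crossMoment Q ((Q ^ i : Kernel Z Z) ∘ₘ μ) G e k) atTop
      (𝓝 (crossMoment Q π G e k)) := by
  simp only [crossMoment_eq_integral hG he hGb heb]
  refine tendsto_integral_comp_pow hπ ht h (C := C * D)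
    (stronglyMeasurable_act_prod hG he).integral_kernel_prod_right' (fun z => ?_) μ
  exact norm_integral_le_of_forall fun z' => norm_act_le_of_le (hGb z') (heb z)

end CrossMoment

end Mixing

/-! ### The stationary past, built from the time-reversed kernel. -/

section BackwardChain

variable {Z : Type*} [MeasurableSpace Z]

/-- The sequence `z, w 0, w 1, …`. -/
def seqCons (p : (ℕ → Z) × Z) : ℕ → Z
  | 0 => p.2
  | n + 1 => p.1 n

theorem measurable_seqCons : Measurable (seqCons : (ℕ → Z) × Z → ℕ → Z) := by
  refine measurable_pi_lambda _ fun n => ?_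
  cases n with
  | zero => exact measurable_snd
  | succ n => exact (measurable_pi_apply n).comp measurable_fst

/-- The iterated integral
`f 0 z * ∫ f 1 z₁ * ∫ f 2 z₂ * ⋯ ∂(R z₁) ∂(R z)` with `n` integrals. -/
noncomputable def iterLIntegral (R : Kernel Z Z) : ℕ → (ℕ → Z → ℝ≥0∞) → Z → ℝ≥0∞
  | 0, f, z => f 0 z
  | n + 1, f, z => f 0 z * ∫⁻ z', iterLIntegral R n (fun i => f (i + 1)) z' ∂(R z)

theorem measurable_iterLIntegral (R : Kernel Z Z) (n : ℕ) {f : ℕ → Z → ℝ≥0∞}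
    (hf : ∀ i, Measurable (f i)) : Measurable (iterLIntegral R n f) := by
  induction n generalizing f with
  | zero => exact hf 0
  | succ n ih => exact (hf 0).mul (ih fun i => hf (i + 1)).lintegral_kernel

/-- The definition peels off the first integral; this peels off the last, matching the way
`chainLaw` is extended one coordinate at a time. -/
theorem iterLIntegral_succ (R : Kernel Z Z) (n : ℕ) (f : ℕ → Z → ℝ≥0∞) :
    iterLIntegral R (n + 1) f = iterLIntegral R n
      (Function.update f n fun z => f n z * ∫⁻ z', f (n + 1) z' ∂(R z)) := by
  induction n generalizing f with
  | zero => funext z; simp [iterLIntegral]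
  | succ n ih =>
    funext z
    rw [iterLIntegral, ih, iterLIntegral]
    have : (fun i => Function.update f (n + 1)
        (fun z => f (n + 1) z * ∫⁻ z', f (n + 1 + 1) z' ∂(R z)) (i + 1))
        = Function.update (fun i => f (i + 1)) n
          (fun z => f (n + 1) z * ∫⁻ z', f (n + 1 + 1) z' ∂(R z)) := by
      funext i
      by_cases h : i = n
      · subst h; simp
      · simp [h]
    rw [this]
    simp

theorem iterLIntegral_update_zero (R : Kernel Z Z) (n : ℕ) (f : ℕ → Z → ℝ≥0∞) (g : Z → ℝ≥0∞)
    (z : Z) : iterLIntegral R n (Function.update f 0 fun z => g z * f 0 z) z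
      = g z * iterLIntegral R n f z := by
  cases n with
  | zero => simp [iterLIntegral]
  | succ n => simp [iterLIntegral, mul_assoc]

/-- Finite products of functions of the coordinates determine a law on sequences. -/
theorem ext_of_lintegral_prod {μ ν : Measure (ℕ → Z)} [IsProbabilityMeasure μ]
    [IsProbabilityMeasure ν]
    (h : ∀ n (f : ℕ → Z → ℝ≥0∞), (∀ i, Measurable (f i)) →
      ∫⁻ w, ∏ i ∈ Finset.range (n + 2), f i (w i) ∂μ
        = ∫⁻ w, ∏ i ∈ Finset.range (n + 2), f i (w i) ∂ν) : μ = ν := by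
  classical
  refine ext_of_generate_finite (squareCylinders fun _ : ℕ => {s : Set Z | MeasurableSet s})
    generateFrom_squareCylinders.symm
    (isPiSystem_squareCylinders (fun _ => MeasurableSpace.isPiSystem_measurableSet) (by simp)) ?_
    (by simp)
  rintro S ⟨s, t, ht, rfl⟩
  have ht' : ∀ i, MeasurableSet (t i) := fun i => ht i (Set.mem_univ i)
  set f : ℕ → Z → ℝ≥0∞ := fun i => if i ∈ s then (t i).indicator 1 else 1 with hf
  have hfm : ∀ i, Measurable (f i) := fun i => by
    by_cases hi : i ∈ s
    · simp only [hf, hi, if_true]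
      exact measurable_one.indicator (ht' i)
    · simp only [hf, hi, if_false]
      exact measurable_one
  -- Coordinates outside s carry the function 1, so factors can be added freely; having at least two
  -- suits `chainLaw_cons`.
  obtain ⟨N, hN⟩ : ∃ N, s ⊆ Finset.range (N + 2) :=
    ⟨s.sup id, fun i hi => Finset.mem_range.2
      (lt_of_le_of_lt (Finset.le_sup (f := id) hi) (by simp))⟩
  have hprod : ∀ w : ℕ → Z, ∏ i ∈ Finset.range (N + 2), f i (w i)
      = ((s : Set ℕ).pi t).indicator 1 w := fun w => by
    by_cases hw : w ∈ (s : Set ℕ).pi t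
    · rw [Set.indicator_of_mem hw]
      refine Finset.prod_eq_one fun i _ => ?_
      by_cases hi : i ∈ s
      · simp [hf, hi, hw i hi]
      · simp [hf, hi]
    · rw [Set.indicator_of_notMem hw]
      simp only [Set.mem_pi, not_forall] at hw
      obtain ⟨i, hi, hwi⟩ := hw
      have hi' : i ∈ s := hi
      exact Finset.prod_eq_zero (hN hi') (by simp [hf, hi', hwi])
  have hm : MeasurableSet ((s : Set ℕ).pi t) :=
    MeasurableSet.pi s.countable_toSet fun i _ => ht' i
  have := h N f hfm
  simp only [hprod, lintegral_indicator_one hm] at this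
  exact this

/-- The law of the chain with kernel `R` and initial law `π`. -/
noncomputable def chainLaw (R : Kernel Z Z) [IsMarkovKernel R] (π : Measure Z)
    [IsProbabilityMeasure π] : Measure (ℕ → Z) :=
  Kernel.trajMeasure (X := fun _ => Z) π fun n =>
    R.comap (fun x : Finset.Iic n → Z => x ⟨n, Finset.mem_Iic.2 le_rfl⟩) (measurable_pi_apply _)

variable {R : Kernel Z Z} [IsMarkovKernel R] {π : Measure Z} [IsProbabilityMeasure π]

instance : IsProbabilityMeasure (chainLaw R π) :=
  inferInstanceAs (IsProbabilityMeasure (Kernel.trajMeasure (X := fun _ => Z) π _))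

theorem chainLaw_map_zero : (chainLaw R π).map (fun w => w 0) = π := by
  have h : (chainLaw R π).map (fun w => w 0)
      = ((chainLaw R π).map (Preorder.frestrictLe 0)).map
        (fun x : Finset.Iic 0 → Z => x ⟨0, Finset.mem_Iic.2 le_rfl⟩) := by
    rw [Measure.map_map (measurable_pi_apply _) (by fun_prop)]
    rfl
  have h' : (chainLaw R π).map (Preorder.frestrictLe 0)
      = π.map (MeasurableEquiv.piUnique fun _ : Finset.Iic 0 => Z).symm := by
    rw [chainLaw, Kernel.trajMeasure, Measure.map_comp _ _ (by fun_prop),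
      Kernel.traj_map_frestrictLe, Kernel.partialTraj_self, Measure.id_comp]
  rw [h, h', Measure.map_map (measurable_pi_apply _) (by fun_prop)]
  exact Measure.map_id

theorem lintegral_chainLaw_prod (n : ℕ) {f : ℕ → Z → ℝ≥0∞} (hf : ∀ i, Measurable (f i)) :
    ∫⁻ w, ∏ i ∈ Finset.range (n + 1), f i (w i) ∂(chainLaw R π)
      = ∫⁻ z, iterLIntegral R n f z ∂π := by
  induction n generalizing f with
  | zero =>
    conv_rhs => rw [← chainLaw_map_zero (R := R) (π := π)]
    rw [lintegral_map (measurable_iterLIntegral R 0 hf) (measurable_pi_apply 0)]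
    simp [iterLIntegral]
  | succ n ih =>
    set f' := Function.update f n fun z => f n z * ∫⁻ z', f (n + 1) z' ∂(R z) with hf'
    have hRm : Measurable fun z => ∫⁻ z', f (n + 1) z' ∂(R z) := (hf (n + 1)).lintegral_kernel
    have hf'm : ∀ i, Measurable (f' i) := fun i => by
      by_cases hi : i = n
      · subst hi
        simp only [hf', Function.update_self]
        exact (hf i).mul hRm
      · simp only [hf', Function.update_of_ne hi]
        exact hf i
    rw [iterLIntegral_succ, ← ih hf'm]
    let F : (Finset.Iic n → Z) × Z → ℝ≥0∞ := fun p =>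
      (∏ i : Finset.Iic n, f i (p.1 i)) * f (n + 1) p.2
    have hF : Measurable F := by
      refine Measurable.mul ?_ ((hf _).comp measurable_snd)
      exact Finset.measurable_prod _ fun i _ =>
        (hf i).comp ((measurable_pi_apply i).comp measurable_fst)
    have hprod : ∀ (w : ℕ → Z) (g : ℕ → Z → ℝ≥0∞), ∏ i : Finset.Iic n, g i (w i)
        = ∏ i ∈ Finset.range (n + 1), g i (w i) := fun w g => by
      rw [Finset.prod_coe_sort (Finset.Iic n) (fun i => g i (w i)), Nat.range_succ_eq_Iic]
    -- The coordinates up to n together with the next one follow the truncated law composed with R;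
    -- integrating out the last one turns `f n` into `f' n`.
    have key := Kernel.map_frestrictLe_trajMeasure_compProd_eq_map_trajMeasure (X := fun _ => Z)
      (μ₀ := π) (κ := fun n => R.comap (fun x : Finset.Iic n → Z =>
        x ⟨n, Finset.mem_Iic.2 le_rfl⟩) (measurable_pi_apply _)) (a := n)
    have key2 := congrArg (fun ρ => ∫⁻ p, F p ∂ρ) key
    rw [lintegral_map hF (by fun_prop), Measure.lintegral_compProd hF,
      lintegral_map hF.lintegral_kernel_prod_right' (by fun_prop)] at key2
    calc _ = ∫⁻ w, F (Preorder.frestrictLe n w, w (n + 1)) ∂(chainLaw R π) := by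
          refine lintegral_congr fun w => ?_
          rw [Finset.prod_range_succ, ← hprod]
          rfl
      _ = _ := by
          refine key2.symm.trans (lintegral_congr fun w => ?_)
          simp only [F]
          rw [lintegral_const_mul _ (hf _), Kernel.comap_apply]
          have e : ∏ i : Finset.Iic n, f i (Preorder.frestrictLe (π := fun _ => Z) n w i)
              = ∏ i ∈ Finset.range (n + 1), f i (w i) := hprod w f
          rw [e, Finset.prod_range_succ, Finset.prod_range_succ, mul_assoc]
          congr 1
          · refine Finset.prod_congr rfl fun i hi => ?_
            rw [hf', Function.update_of_ne (Finset.mem_range.1 hi).ne]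
          · rw [hf', Function.update_self]
            rfl

/-- If `R` is the time reversal of `Q`, then the law of the chain driven by `R` is invariant
under prepending a `Q`-step from its first point. -/
theorem chainLaw_cons {Q : Kernel Z Z} [IsMarkovKernel Q]
    (hrev : π ⊗ₘ R = (π ⊗ₘ Q).map Prod.swap) :
    (chainLaw R π ⊗ₘ Q.comap (fun w : ℕ → Z => w 0) (measurable_pi_apply 0)).map seqCons
      = chainLaw R π := by
  have : IsProbabilityMeasure ((chainLaw R π ⊗ₘ Q.comap (fun w : ℕ → Z => w 0)
      (measurable_pi_apply 0)).map seqCons) :=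
    Measure.isProbabilityMeasure_map measurable_seqCons.aemeasurable
  refine ext_of_lintegral_prod fun n f hf => ?_
  have hPm : ∀ m (g : ℕ → Z → ℝ≥0∞), (∀ i, Measurable (g i)) →
      Measurable fun w : ℕ → Z => ∏ i ∈ Finset.range m, g i (w i) := fun m g hg =>
    Finset.measurable_prod _ fun i _ => (hg i).comp (measurable_pi_apply i)
  have hPs : Measurable fun p : (ℕ → Z) × Z => ∏ i ∈ Finset.range (n + 2), f i (seqCons p i) :=
    (hPm _ _ hf).comp measurable_seqCons
  have hQm : Measurable fun z => ∫⁻ z', f 0 z' ∂(Q z) := (hf 0).lintegral_kernel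
  have hVm := measurable_iterLIntegral R n (f := fun i => f (i + 1)) fun i => hf (i + 1)
  have hS1 : Measurable fun p : Z × Z => f 0 p.1 * iterLIntegral R n (fun i => f (i + 1)) p.2 :=
    ((hf 0).comp measurable_fst).mul (hVm.comp measurable_snd)
  have hS2 : Measurable fun p : Z × Z => f 0 p.2 * iterLIntegral R n (fun i => f (i + 1)) p.1 :=
    ((hf 0).comp measurable_snd).mul (hVm.comp measurable_fst)
  rw [lintegral_map (hPm _ _ hf) measurable_seqCons,
    Measure.lintegral_compProd hPs,
    lintegral_chainLaw_prod (n + 1) hf]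
  -- The prepended point depends on the sequence through w 0 only, so integrating it out changes
  -- only the factor at w 0.
  set g : ℕ → Z → ℝ≥0∞ := Function.update (fun i => f (i + 1)) 0
    (fun z => (∫⁻ z', f 0 z' ∂(Q z)) * f 1 z) with hg
  have hgm : ∀ i, Measurable (g i) := fun i => by
    cases i with
    | zero => simp only [hg, Function.update_self]; exact hQm.mul (hf 1)
    | succ i => simp only [hg, Function.update_of_ne (Nat.succ_ne_zero i)]; exact hf _
  calc _ = ∫⁻ w, ∏ i ∈ Finset.range (n + 1), g i (w i) ∂(chainLaw R π) := by
        refine lintegral_congr fun w => ?_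
        rw [Kernel.comap_apply]
        have e : ∀ z, ∏ i ∈ Finset.range (n + 2), f i (seqCons (w, z) i)
            = (∏ i ∈ Finset.range (n + 1), f (i + 1) (w i)) * f 0 z := fun z => by
          rw [Finset.prod_range_succ']
          rfl
        simp only [e]
        rw [lintegral_const_mul _ (hf 0), Finset.prod_range_succ', Finset.prod_range_succ',
          mul_assoc]
        congr 1
        simp only [hg, Function.update_self]
        ring
    _ = ∫⁻ z, (∫⁻ z', f 0 z' ∂(Q z)) * iterLIntegral R n (fun i => f (i + 1)) z ∂π := by
        rw [lintegral_chainLaw_prod n hgm]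
        exact lintegral_congr fun z => iterLIntegral_update_zero R n _ _ z
    _ = ∫⁻ p, f 0 p.2 * iterLIntegral R n (fun i => f (i + 1)) p.1 ∂(π ⊗ₘ Q) := by
        rw [Measure.lintegral_compProd hS2]
        refine lintegral_congr fun z => ?_
        exact (lintegral_mul_const _ (hf 0)).symm
    -- The only use of reversal: a Q-step from w 0 to the new point is an R-step from the new point
    -- to w 0.
    _ = ∫⁻ p, f 0 p.1 * iterLIntegral R n (fun i => f (i + 1)) p.2 ∂(π ⊗ₘ R) := by
        rw [hrev, lintegral_map hS1 measurable_swap]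
        rfl
    _ = _ := by
        rw [Measure.lintegral_compProd hS1]
        refine lintegral_congr fun z => ?_
        rw [iterLIntegral]
        exact lintegral_const_mul (f 0 z) hVm

/-- Chapman–Kolmogorov with the starting point kept in the integrand. -/
theorem lintegral_compProd_pow_succ {Q : Kernel Z Z} [IsMarkovKernel Q] (μ : Measure Z)
    [SFinite μ] (k : ℕ) {f : Z × Z → ℝ≥0∞} (hf : Measurable f) :
    (Measurable fun p : Z × Z => ∫⁻ z, f (p.1, z) ∂(Q p.2)) ∧
    ∫⁻ p, ∫⁻ z, f (p.1, z) ∂(Q p.2) ∂(μ ⊗ₘ (Q ^ k)) = ∫⁻ p, f p ∂(μ ⊗ₘ (Q ^ (k + 1))) := by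
  have hq : Measurable fun p : Z × Z => ∫⁻ z, f (p.1, z) ∂(Q p.2) := by
    have : Measurable fun q : (Z × Z) × Z => f (q.1.1, q.2) :=
      hf.comp ((measurable_fst.comp measurable_fst).prodMk measurable_snd)
    exact this.lintegral_kernel_prod_right' (κ := Q.comap Prod.snd measurable_snd)
  refine ⟨hq, ?_⟩
  rw [Measure.lintegral_compProd hq, Measure.lintegral_compProd hf]
  refine lintegral_congr fun a => ?_
  rw [pow_succ']
  exact (Kernel.lintegral_comp Q (Q ^ k) a (hf.comp measurable_prodMk_left)).symm

/-- For a law of sequences invariant under prepending a `Q`-step, the pair of the `k`-th and the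
first points is a `k`-step transition of `Q`. -/
theorem map_pair_of_cons_invariant {Q : Kernel Z Z} [IsMarkovKernel Q] {P : Measure (ℕ → Z)}
    [IsProbabilityMeasure P]
    (hP : (P ⊗ₘ Q.comap (fun w : ℕ → Z => w 0) (measurable_pi_apply 0)).map seqCons = P)
    (h0 : P.map (fun w => w 0) = π) (k : ℕ) : P.map (fun w => (w k, w 0)) = π ⊗ₘ (Q ^ k) := by
  have hm : ∀ k, Measurable fun w : ℕ → Z => (w k, w 0) := fun k =>
    (measurable_pi_apply k).prodMk (measurable_pi_apply 0)
  induction k with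
  | zero =>
    refine Measure.ext_of_lintegral _ fun f hf => ?_
    rw [show Q ^ 0 = Kernel.id from rfl, Measure.lintegral_compProd hf, lintegral_map hf (hm 0),
      ← h0]
    rw [lintegral_map hf.lintegral_kernel_prod_right' (measurable_pi_apply 0)]
    refine lintegral_congr fun w => ?_
    exact (lintegral_dirac' (w 0) (hf.comp measurable_prodMk_left)).symm
  | succ k ih =>
    refine Measure.ext_of_lintegral _ fun f hf => ?_
    obtain ⟨hq, hq'⟩ := lintegral_compProd_pow_succ (Q := Q) π k hf
    have hmf : Measurable fun q : (ℕ → Z) × Z => f (q.1 k, q.2) :=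
      hf.comp (((measurable_pi_apply k).comp measurable_fst).prodMk measurable_snd)
    -- After prepending, the old w k has index k + 1, and the new w 0 is a Q-step from the old one.
    calc ∫⁻ p, f p ∂(P.map fun w => (w (k + 1), w 0))
        = ∫⁻ q, f (q.1 k, q.2) ∂(P ⊗ₘ Q.comap (fun w : ℕ → Z => w 0) (measurable_pi_apply 0)) := by
          conv_lhs => rw [← hP]
          rw [Measure.map_map (hm _) measurable_seqCons, lintegral_map hf ((hm _).comp
            measurable_seqCons)]
          rfl
      _ = ∫⁻ w, ∫⁻ z, f (w k, z) ∂(Q (w 0)) ∂P := by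
          rw [Measure.lintegral_compProd hmf]
          rfl
      _ = ∫⁻ p, ∫⁻ z, f (p.1, z) ∂(Q p.2) ∂(π ⊗ₘ (Q ^ k)) := by
          rw [← ih, lintegral_map hq (hm k)]
      _ = _ := hq'

/-- The conditional law of the present point given the next one exists on a standard Borel space: it
is `posterior Q π`, a time reversal because π is invariant. The index k counts steps into the past.
-/
theorem exists_backward_law [StandardBorelSpace Z] {Q : Kernel Z Z} [IsMarkovKernel Q]
    (hπ : Q.Invariant π) : ∃ P : Measure (ℕ → Z), IsProbabilityMeasure P ∧
      (P ⊗ₘ Q.comap (fun w : ℕ → Z => w 0) (measurable_pi_apply 0)).map seqCons = P ∧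
      ∀ k : ℕ, P.map (fun w => (w k, w 0)) = π ⊗ₘ (Q ^ k) := by
  have : Nonempty Z := nonempty_of_isProbabilityMeasure π
  have hrev : π ⊗ₘ (posterior Q π) = (π ⊗ₘ Q).map Prod.swap := by
    have h := compProd_posterior_eq_map_swap (κ := Q) (μ := π)
    rwa [hπ.def] at h
  have hP := chainLaw_cons hrev
  exact ⟨chainLaw (posterior Q π) π, inferInstance, hP,
    map_pair_of_cons_invariant hP chainLaw_map_zero⟩

end BackwardChain

/-! ### Series weighted by the powers of a stable matrix. -/

section GeometricSum

variable {d : ℕ} {B : Matrix (Fin d) (Fin d) ℝ} {c r D : ℝ}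

/-- The sum `∑ Bᵏ u k`. -/
noncomputable def geomSum (B : Matrix (Fin d) (Fin d) ℝ) (u : ℕ → EuclideanSpace ℝ (Fin d)) :
    EuclideanSpace ℝ (Fin d) :=
  ∑' k, act (B ^ k) (u k)

theorem norm_act_pow_le (hB : ∀ n : ℕ, ‖B ^ n‖ ≤ c * r ^ n)
    {u : ℕ → EuclideanSpace ℝ (Fin d)} (hu : ∀ k, ‖u k‖ ≤ D) (k : ℕ) :
    ‖act (B ^ k) (u k)‖ ≤ c * D * r ^ k :=
  (norm_act_le_of_le (hB k) (hu k)).trans (le_of_eq (by ring))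

theorem summable_geom_bound (hr0 : 0 ≤ r) (hr1 : r < 1) (b : ℝ) :
    Summable fun k : ℕ => b * r ^ k :=
  (summable_geometric_of_lt_one hr0 hr1).mul_left _

theorem summable_geomSum (hr0 : 0 ≤ r) (hr1 : r < 1) (hB : ∀ n : ℕ, ‖B ^ n‖ ≤ c * r ^ n)
    {u : ℕ → EuclideanSpace ℝ (Fin d)} (hu : ∀ k, ‖u k‖ ≤ D) :
    Summable fun k => act (B ^ k) (u k) :=
  Summable.of_norm_bounded (summable_geom_bound hr0 hr1 (c * D)) (norm_act_pow_le hB hu)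

theorem norm_geomSum_le (hr0 : 0 ≤ r) (hr1 : r < 1) (hB : ∀ n : ℕ, ‖B ^ n‖ ≤ c * r ^ n)
    {u : ℕ → EuclideanSpace ℝ (Fin d)} (hu : ∀ k, ‖u k‖ ≤ D) :
    ‖geomSum B u‖ ≤ c * D * (1 - r)⁻¹ := by
  refine tsum_of_norm_bounded ?_ (norm_act_pow_le hB hu)
  exact (hasSum_geometric_of_lt_one hr0 hr1).mul_left _

theorem geomSum_eq (hr0 : 0 ≤ r) (hr1 : r < 1) (hB : ∀ n : ℕ, ‖B ^ n‖ ≤ c * r ^ n)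
    {u : ℕ → EuclideanSpace ℝ (Fin d)} (hu : ∀ k, ‖u k‖ ≤ D) :
    geomSum B u = u 0 + act B (geomSum B fun k => u (k + 1)) := by
  rw [geomSum, (summable_geomSum hr0 hr1 hB hu).tsum_eq_zero_add, pow_zero, act_one]
  congr 1
  rw [geomSum, act, (Matrix.toEuclideanCLM (n := Fin d) (𝕜 := ℝ) B).map_tsum
    (summable_geomSum hr0 hr1 hB fun k => hu (k + 1))]
  refine tsum_congr fun k => ?_
  rw [pow_succ', act_mul]

theorem measurable_act_const {Y : Type*} [MeasurableSpace Y] (M : Matrix (Fin d) (Fin d) ℝ)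
    {u : Y → EuclideanSpace ℝ (Fin d)} (hu : Measurable u) : Measurable fun y => act M (u y) :=
  measurable_act (M := fun _ => M) (fun _ _ => measurable_const) hu

theorem measurable_geomSum {Y : Type*} [MeasurableSpace Y] (hr0 : 0 ≤ r) (hr1 : r < 1)
    (hB : ∀ n : ℕ, ‖B ^ n‖ ≤ c * r ^ n) {u : Y → ℕ → EuclideanSpace ℝ (Fin d)}
    (hu : ∀ y k, ‖u y k‖ ≤ D) (hm : ∀ k, Measurable fun y => u y k) :
    Measurable fun y => geomSum B (u y) := by
  refine measurable_of_tendsto_metrizable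
    (f := fun n y => ∑ k ∈ Finset.range n, act (B ^ k) (u y k)) (fun n => ?_) ?_
  · exact Finset.measurable_sum _ fun k _ => measurable_act_const _ (hm k)
  · exact tendsto_pi_nhds.2 fun y => (summable_geomSum hr0 hr1 hB (hu y)).hasSum.tendsto_sum_nat

end GeometricSum

/-! ### The stationary state as a function of the past, and its invariant law. -/

section Stationary

variable {Z : Type*} {d : ℕ}

/-- The stationary value of `J⁽⁰⁾` as a function of the past `w 0, w 1, …`, the most recent point
first. -/
noncomputable def pastJ0 (α : ℝ) (Abar : Matrix (Fin d) (Fin d) ℝ)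
    (e : Z → EuclideanSpace ℝ (Fin d)) (w : ℕ → Z) : EuclideanSpace ℝ (Fin d) :=
  -(α • geomSum (1 - α • Abar) fun k => e (w k))

/-- The stationary value of `J⁽¹⁾` as a function of the past `w 0, w 1, …`, the most recent point
first. -/
noncomputable def pastJ1 (α : ℝ) (Abar : Matrix (Fin d) (Fin d) ℝ)
    (G : Z → Matrix (Fin d) (Fin d) ℝ) (e : Z → EuclideanSpace ℝ (Fin d)) (w : ℕ → Z) :
    EuclideanSpace ℝ (Fin d) :=
  -(α • geomSum (1 - α • Abar) fun k => act (G (w k)) (pastJ0 α Abar e fun i => w (i + (k + 1))))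

/-- The stationary value of `(Z, J⁽⁰⁾, J⁽¹⁾)` as a function of the past. -/
noncomputable def pastState (α : ℝ) (Abar : Matrix (Fin d) (Fin d) ℝ)
    (G : Z → Matrix (Fin d) (Fin d) ℝ) (e : Z → EuclideanSpace ℝ (Fin d)) (w : ℕ → Z) :
    Z × EuclideanSpace ℝ (Fin d) × EuclideanSpace ℝ (Fin d) :=
  (w 0, pastJ0 α Abar e fun i => w (i + 1), pastJ1 α Abar G e fun i => w (i + 1))

variable {α c r C D : ℝ} {Abar : Matrix (Fin d) (Fin d) ℝ} {G : Z → Matrix (Fin d) (Fin d) ℝ}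
  {e : Z → EuclideanSpace ℝ (Fin d)}

theorem neg_smul_add_act (α : ℝ) (B : Matrix (Fin d) (Fin d) ℝ) (u g : EuclideanSpace ℝ (Fin d)) :
    -(α • (u + act B g)) = act B (-(α • g)) - α • u := by
  have h : act B (-(α • g)) = -(α • act B g) := by
    rw [← act_vec_smul]
    exact map_neg _ _
  rw [h, smul_add]
  abel

theorem norm_pastJ0_le (hr0 : 0 ≤ r) (hr1 : r < 1)
    (hB : ∀ n : ℕ, ‖(1 - α • Abar) ^ n‖ ≤ c * r ^ n) (heb : ∀ z, ‖e z‖ ≤ D) (w : ℕ → Z) :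
    ‖pastJ0 α Abar e w‖ ≤ |α| * (c * D * (1 - r)⁻¹) := by
  rw [pastJ0, norm_neg, norm_smul, Real.norm_eq_abs]
  gcongr
  exact norm_geomSum_le hr0 hr1 hB fun k => heb (w k)

theorem norm_pastJ1_le (hr0 : 0 ≤ r) (hr1 : r < 1)
    (hB : ∀ n : ℕ, ‖(1 - α • Abar) ^ n‖ ≤ c * r ^ n) (heb : ∀ z, ‖e z‖ ≤ D)
    (hGb : ∀ z, ‖G z‖ ≤ C) (w : ℕ → Z) :
    ‖pastJ1 α Abar G e w‖
      ≤ |α| * (c * (C * (|α| * (c * D * (1 - r)⁻¹))) * (1 - r)⁻¹) := by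
  rw [pastJ1, norm_neg, norm_smul, Real.norm_eq_abs]
  gcongr
  exact norm_geomSum_le hr0 hr1 hB fun k => norm_act_le_of_le (hGb (w k))
    (norm_pastJ0_le hr0 hr1 hB heb _)

theorem pastJ0_eq (hr0 : 0 ≤ r) (hr1 : r < 1)
    (hB : ∀ n : ℕ, ‖(1 - α • Abar) ^ n‖ ≤ c * r ^ n) (heb : ∀ z, ‖e z‖ ≤ D) (w : ℕ → Z) :
    pastJ0 α Abar e w
      = act (1 - α • Abar) (pastJ0 α Abar e fun i => w (i + 1)) - α • e (w 0) := by
  rw [pastJ0, geomSum_eq hr0 hr1 hB fun k => heb (w k), neg_smul_add_act, pastJ0]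

theorem pastJ1_eq (hr0 : 0 ≤ r) (hr1 : r < 1)
    (hB : ∀ n : ℕ, ‖(1 - α • Abar) ^ n‖ ≤ c * r ^ n) (heb : ∀ z, ‖e z‖ ≤ D)
    (hGb : ∀ z, ‖G z‖ ≤ C) (w : ℕ → Z) :
    pastJ1 α Abar G e w = act (1 - α • Abar) (pastJ1 α Abar G e fun i => w (i + 1))
      - α • act (G (w 0)) (pastJ0 α Abar e fun i => w (i + 1)) := by
  rw [pastJ1, geomSum_eq hr0 hr1 hB fun k => norm_act_le_of_le (hGb (w k))
    (norm_pastJ0_le hr0 hr1 hB heb _), neg_smul_add_act, pastJ1]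
  simp only [zero_add, add_assoc]

/-- In `pastState` the point w 0 plays Z_{t+1}, not yet used by J, so the J-components read the
shifted sequence; prepending a point is then exactly one step of the chain. -/
theorem pastState_seqCons (hr0 : 0 ≤ r) (hr1 : r < 1)
    (hB : ∀ n : ℕ, ‖(1 - α • Abar) ^ n‖ ≤ c * r ^ n) (heb : ∀ z, ‖e z‖ ≤ D)
    (hGb : ∀ z, ‖G z‖ ≤ C) (p : (ℕ → Z) × Z) :
    pastState α Abar G e (seqCons p) = (p.2, stepJ α Abar G e (pastState α Abar G e p.1)) := by
  have h1 := pastJ0_eq hr0 hr1 hB heb p.1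
  have h2 := pastJ1_eq hr0 hr1 hB heb hGb p.1
  simp only [stepJ, pastState, seqCons, ← h1, ← h2]

theorem act_pastJ0 (hr0 : 0 ≤ r) (hr1 : r < 1)
    (hB : ∀ n : ℕ, ‖(1 - α • Abar) ^ n‖ ≤ c * r ^ n) (heb : ∀ z, ‖e z‖ ≤ D)
    (M : Matrix (Fin d) (Fin d) ℝ) (w : ℕ → Z) :
    act M (pastJ0 α Abar e w)
      = -(α • ∑' k : ℕ, act M (act ((1 - α • Abar) ^ k) (e (w k)))) := by
  have hs := summable_geomSum hr0 hr1 hB (u := fun k => e (w k)) fun k => heb _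
  have h1 : act M (geomSum (1 - α • Abar) fun k => e (w k))
      = ∑' k : ℕ, act M (act ((1 - α • Abar) ^ k) (e (w k))) :=
    (Matrix.toEuclideanCLM (n := Fin d) (𝕜 := ℝ) M).map_tsum hs
  rw [← h1, ← act_vec_smul]
  exact map_neg _ _

variable [MeasurableSpace Z]

theorem measurable_pastJ0 (hr0 : 0 ≤ r) (hr1 : r < 1)
    (hB : ∀ n : ℕ, ‖(1 - α • Abar) ^ n‖ ≤ c * r ^ n) (heb : ∀ z, ‖e z‖ ≤ D)
    (he : Measurable e) : Measurable fun w : ℕ → Z => pastJ0 α Abar e w :=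
  ((measurable_geomSum (u := fun (w : ℕ → Z) k => e (w k)) hr0 hr1 hB (fun w k => heb (w k))
    fun k => he.comp (measurable_pi_apply k)).const_smul α).neg

theorem measurable_shift (k : ℕ) : Measurable fun (w : ℕ → Z) (i : ℕ) => w (i + k) :=
  measurable_pi_lambda _ fun i => measurable_pi_apply (i + k)

theorem measurable_pastJ1 (hr0 : 0 ≤ r) (hr1 : r < 1)
    (hB : ∀ n : ℕ, ‖(1 - α • Abar) ^ n‖ ≤ c * r ^ n) (heb : ∀ z, ‖e z‖ ≤ D)
    (hGb : ∀ z, ‖G z‖ ≤ C) (he : Measurable e) (hG : ∀ i j, Measurable fun z => G z i j) :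
    Measurable fun w : ℕ → Z => pastJ1 α Abar G e w := by
  refine ((measurable_geomSum (u := fun (w : ℕ → Z) k =>
    act (G (w k)) (pastJ0 α Abar e fun i => w (i + (k + 1)))) hr0 hr1 hB
      (fun w k => norm_act_le_of_le (hGb (w k))
    (norm_pastJ0_le hr0 hr1 hB heb _)) fun k => ?_).const_smul α).neg
  exact measurable_act (M := fun w : ℕ → Z => G (w k))
    (fun i j => (hG i j).comp (measurable_pi_apply k))
    ((measurable_pastJ0 hr0 hr1 hB heb he).comp (measurable_shift (k + 1)))

theorem measurable_pastState (hr0 : 0 ≤ r) (hr1 : r < 1)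
    (hB : ∀ n : ℕ, ‖(1 - α • Abar) ^ n‖ ≤ c * r ^ n) (heb : ∀ z, ‖e z‖ ≤ D)
    (hGb : ∀ z, ‖G z‖ ≤ C) (he : Measurable e) (hG : ∀ i j, Measurable fun z => G z i j) :
    Measurable fun w : ℕ → Z => pastState α Abar G e w :=
  (measurable_pi_apply 0).prodMk
    (((measurable_pastJ0 hr0 hr1 hB heb he).comp (measurable_shift 1)).prodMk
      ((measurable_pastJ1 hr0 hr1 hB heb hGb he hG).comp (measurable_shift 1)))

variable {Q : Kernel Z Z} [IsMarkovKernel Q]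

instance isMarkovKernel_kernelJ1 (hG : ∀ i j, Measurable fun z => G z i j) (he : Measurable e) :
    IsMarkovKernel (kernelJ1 Q α Abar hG he) := by
  unfold kernelJ1; infer_instance

theorem kernelJ1_apply (hG : ∀ i j, Measurable fun z => G z i j) (he : Measurable e)
    (y : Z × EuclideanSpace ℝ (Fin d) × EuclideanSpace ℝ (Fin d)) :
    kernelJ1 Q α Abar hG he y = (Q y.1).map fun z => (z, stepJ α Abar G e y) := by
  rw [kernelJ1, Kernel.prod_apply, Kernel.comap_apply, Kernel.deterministic_apply,
    Measure.prod_dirac]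

/-- `pastState` intertwines prepending a Q-step with the kernel, so it carries the prepend-invariant
P to an invariant law. -/
theorem invariant_map_pastState (hr0 : 0 ≤ r) (hr1 : r < 1)
    (hB : ∀ n : ℕ, ‖(1 - α • Abar) ^ n‖ ≤ c * r ^ n) (heb : ∀ z, ‖e z‖ ≤ D)
    (hGb : ∀ z, ‖G z‖ ≤ C) (he : Measurable e) (hG : ∀ i j, Measurable fun z => G z i j)
    {P : Measure (ℕ → Z)} [IsProbabilityMeasure P]
    (hP : (P ⊗ₘ Q.comap (fun w : ℕ → Z => w 0) (measurable_pi_apply 0)).map seqCons = P) :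
    (kernelJ1 Q α Abar hG he).Invariant (P.map (pastState α Abar G e)) := by
  have hF := measurable_pastState hr0 hr1 hB heb hGb he hG
  refine Measure.ext_of_lintegral _ fun f hf => ?_
  have hfz : ∀ s, Measurable fun z : Z => f (z, s) := fun s => hf.comp measurable_prodMk_right
  have hfF : Measurable fun w => f (pastState α Abar G e w) := hf.comp hF
  have hm : Measurable fun p : (ℕ → Z) × Z => f (pastState α Abar G e (seqCons p)) :=
    hf.comp (hF.comp measurable_seqCons)
  rw [Measure.lintegral_bind (Kernel.aemeasurable _) hf.aemeasurable,
    lintegral_map hf.lintegral_kernel hF, lintegral_map hf hF]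
  conv_rhs => rw [← hP]
  rw [lintegral_map hfF measurable_seqCons, Measure.lintegral_compProd hm]
  refine lintegral_congr fun w => ?_
  rw [kernelJ1_apply, lintegral_map hf measurable_prodMk_right, Kernel.comap_apply]
  simp only [pastState_seqCons hr0 hr1 hB heb hGb]
  rfl

end Stationary

/-! ### The equation satisfied by the stationary mean. -/

section StationaryMean

variable {Z : Type*} [MeasurableSpace Z] {d : ℕ} {Q : Kernel Z Z}
  {α c r C D : ℝ} {Abar : Matrix (Fin d) (Fin d) ℝ} {G : Z → Matrix (Fin d) (Fin d) ℝ}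
  {e : Z → EuclideanSpace ℝ (Fin d)} {P : Measure (ℕ → Z)} [IsProbabilityMeasure P]

/-- Geometric decay of Bᵏ allows exchanging sum and expectation; w (k + 1) and w 0 are k + 1 steps
of Q apart. -/
theorem integral_tsum_act_pow {π : Measure Z} {B : Matrix (Fin d) (Fin d) ℝ}
    (hr0 : 0 ≤ r) (hr1 : r < 1)
    (hB : ∀ n : ℕ, ‖B ^ n‖ ≤ c * r ^ n) (heb : ∀ z, ‖e z‖ ≤ D)
    (hGb : ∀ z, ‖G z‖ ≤ C) (he : Measurable e) (hG : ∀ i j, Measurable fun z => G z i j)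
    (hlaw : ∀ k : ℕ, P.map (fun w => (w k, w 0)) = π ⊗ₘ (Q ^ k)) :
    ∫ w : ℕ → Z, ∑' k : ℕ, act (G (w 0)) (act (B ^ k) (e (w (k + 1)))) ∂P
      = ∑' k : ℕ, crossMoment Q π G (fun z => act (B ^ k) (e z)) (k + 1) := by
  have hterm : ∀ k : ℕ, ∀ w : ℕ → Z, ‖act (G (w 0)) (act (B ^ k) (e (w (k + 1))))‖
      ≤ C * (c * D) * r ^ k := fun k w => by
    have h1 : ‖act (B ^ k) (e (w (k + 1)))‖ ≤ c * r ^ k * D := norm_act_le_of_le (hB k) (heb _)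
    exact (norm_act_le_of_le (hGb (w 0)) h1).trans (le_of_eq (by ring))
  have hm : ∀ k : ℕ, Measurable fun p : Z × Z => act (G p.2) (act (B ^ k) (e p.1)) := fun k =>
    (stronglyMeasurable_act_prod (e := fun z => act (B ^ k) (e z)) hG
      (measurable_act_const (B ^ k) he)).measurable
  have hpair : ∀ k : ℕ, Measurable fun w : ℕ → Z => (w k, w 0) := fun k =>
    (measurable_pi_apply k).prodMk (measurable_pi_apply 0)
  have hmw : ∀ k : ℕ, Measurable fun w : ℕ → Z => act (G (w 0)) (act (B ^ k) (e (w (k + 1)))) :=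
    fun k => measurable_act (M := fun w : ℕ → Z => G (w 0))
      (fun i j => (hG i j).comp (measurable_pi_apply 0))
      (measurable_act_const (B ^ k) (he.comp (measurable_pi_apply (k + 1))))
  have hint : ∀ k : ℕ,
      Integrable (fun w : ℕ → Z => act (G (w 0)) (act (B ^ k) (e (w (k + 1))))) P :=
    fun k => integrable_of_bound (hmw k).stronglyMeasurable (hterm k)
  have hsum : Summable fun k : ℕ =>
      ∫ w : ℕ → Z, ‖act (G (w 0)) (act (B ^ k) (e (w (k + 1))))‖ ∂P := by
    refine Summable.of_nonneg_of_le (fun k => integral_nonneg fun w => norm_nonneg _) (fun k => ?_)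
      (summable_geom_bound hr0 hr1 (C * (c * D)))
    have := norm_integral_le_of_forall (μ := P) (f := fun w : ℕ → Z =>
      ‖act (G (w 0)) (act (B ^ k) (e (w (k + 1))))‖) fun w => by rw [norm_norm]; exact hterm k w
    exact (le_abs_self _).trans this
  refine (integral_tsum_of_summable_integral_norm hint hsum).symm.trans (tsum_congr fun k => ?_)
  rw [crossMoment, ← hlaw, integral_map (hpair (k + 1)).aemeasurable (hm k).aestronglyMeasurable]

theorem integral_act_pastJ0 {π : Measure Z} (hr0 : 0 ≤ r) (hr1 : r < 1)
    (hB : ∀ n : ℕ, ‖(1 - α • Abar) ^ n‖ ≤ c * r ^ n) (heb : ∀ z, ‖e z‖ ≤ D)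
    (hGb : ∀ z, ‖G z‖ ≤ C) (he : Measurable e) (hG : ∀ i j, Measurable fun z => G z i j)
    (hlaw : ∀ k : ℕ, P.map (fun w => (w k, w 0)) = π ⊗ₘ (Q ^ k)) :
    ∫ w, act (G (w 0)) (pastJ0 α Abar e fun i => w (i + 1)) ∂P
      = -(α • ∑' k : ℕ, crossMoment Q π G (fun z => act ((1 - α • Abar) ^ k) (e z)) (k + 1)) := by
  rw [← integral_tsum_act_pow hr0 hr1 hB heb hGb he hG hlaw, ← integral_smul, ← integral_neg]
  exact integral_congr_ae (Eventually.of_forall fun w => act_pastJ0 hr0 hr1 hB heb (G (w 0)) _)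

variable [IsMarkovKernel Q]

theorem map_shift_of_cons_invariant
    (hP : (P ⊗ₘ Q.comap (fun w : ℕ → Z => w 0) (measurable_pi_apply 0)).map seqCons = P) :
    P.map (fun w i => w (i + 1)) = P := by
  conv_lhs => rw [← hP]
  rw [Measure.map_map (measurable_shift 1) measurable_seqCons]
  exact Measure.fst_compProd _ _

/-- The mean of the stationary `J⁽¹⁾`. -/
theorem act_integral_pastState {π : Measure Z} (hα : α ≠ 0) (hr0 : 0 ≤ r) (hr1 : r < 1)
    (hB : ∀ n : ℕ, ‖(1 - α • Abar) ^ n‖ ≤ c * r ^ n) (heb : ∀ z, ‖e z‖ ≤ D)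
    (hGb : ∀ z, ‖G z‖ ≤ C) (he : Measurable e) (hG : ∀ i j, Measurable fun z => G z i j)
    (hP : (P ⊗ₘ Q.comap (fun w : ℕ → Z => w 0) (measurable_pi_apply 0)).map seqCons = P)
    (hlaw : ∀ k : ℕ, P.map (fun w => (w k, w 0)) = π ⊗ₘ (Q ^ k)) :
    Integrable (fun y => y.2.2) (P.map (pastState α Abar G e)) ∧
    act Abar (∫ y, y.2.2 ∂(P.map (pastState α Abar G e)))
      = α • ∑' k : ℕ, crossMoment Q π G (fun z => act ((1 - α • Abar) ^ k) (e z)) (k + 1) := by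
  have hF := measurable_pastState hr0 hr1 hB heb hGb he hG
  have hJ0 := measurable_pastJ0 hr0 hr1 hB heb he
  have hJ1 := measurable_pastJ1 hr0 hr1 hB heb hGb he hG
  have hi1 : Integrable (fun w => pastJ1 α Abar G e w) P :=
    integrable_of_bound hJ1.stronglyMeasurable (norm_pastJ1_le hr0 hr1 hB heb hGb)
  have hi1s : Integrable (fun w : ℕ → Z => pastJ1 α Abar G e fun i => w (i + 1)) P :=
    integrable_of_bound (hJ1.comp (measurable_shift 1)).stronglyMeasurable
      fun w => norm_pastJ1_le hr0 hr1 hB heb hGb _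
  have hsnd : Measurable fun y : Z × EuclideanSpace ℝ (Fin d) × EuclideanSpace ℝ (Fin d) => y.2.2 :=
    measurable_snd.comp measurable_snd
  have hmG : Measurable fun w : ℕ → Z => act (G (w 0)) (pastJ0 α Abar e fun i => w (i + 1)) :=
    measurable_act (M := fun w : ℕ → Z => G (w 0))
      (fun i j => (hG i j).comp (measurable_pi_apply 0)) (hJ0.comp (measurable_shift 1))
  have hiG : Integrable (fun w : ℕ → Z =>
      act (G (w 0)) (pastJ0 α Abar e fun i => w (i + 1))) P :=
    integrable_of_bound hmG.stronglyMeasurable fun w =>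
      norm_act_le_of_le (hGb _) (norm_pastJ0_le hr0 hr1 hB heb _)
  refine ⟨?_, ?_⟩
  · rw [integrable_map_measure hsnd.aestronglyMeasurable hF.aemeasurable]
    exact hi1s
  -- `pastState` evaluates `pastJ1` on the shifted sequence; shift invariance of P removes the
  -- shift.
  have em : ∫ y, y.2.2 ∂(P.map (pastState α Abar G e)) = ∫ w, pastJ1 α Abar G e w ∂P := by
    rw [integral_map hF.aemeasurable hsnd.aestronglyMeasurable]
    conv_rhs => rw [← map_shift_of_cons_invariant hP]
    rw [integral_map (measurable_shift 1).aemeasurable hJ1.aestronglyMeasurable]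
    rfl
  have es : ∫ w, pastJ1 α Abar G e w ∂P
      = ∫ w : ℕ → Z, (pastJ1 α Abar G e fun i => w (i + 1)) ∂P := by
    conv_lhs => rw [← map_shift_of_cons_invariant hP]
    rw [integral_map (measurable_shift 1).aemeasurable hJ1.aestronglyMeasurable]
  set m := ∫ w, pastJ1 α Abar G e w ∂P with hmdef
  -- The expectation of the one-step recursion; m cancels and αĀm = α²S remains.
  have hrec : m = act (1 - α • Abar) m
      - α • ∫ w, act (G (w 0)) (pastJ0 α Abar e fun i => w (i + 1)) ∂P := by
    have h1 : act (1 - α • Abar) m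
        = ∫ w : ℕ → Z, act (1 - α • Abar) (pastJ1 α Abar G e fun i => w (i + 1)) ∂P := by
      rw [es]
      exact (ContinuousLinearMap.integral_comp_comm _ hi1s).symm
    have hiB : Integrable (fun w : ℕ → Z =>
        act (1 - α • Abar) (pastJ1 α Abar G e fun i => w (i + 1))) P :=
      ContinuousLinearMap.integrable_comp _ hi1s
    have hiα : Integrable (fun w : ℕ → Z =>
        α • act (G (w 0)) (pastJ0 α Abar e fun i => w (i + 1))) P := hiG.smul α
    rw [h1, ← integral_smul, ← integral_sub hiB hiα, hmdef]
    exact integral_congr_ae (Eventually.of_forall fun w => pastJ1_eq hr0 hr1 hB heb hGb w)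
  rw [integral_act_pastJ0 hr0 hr1 hB heb hGb he hG hlaw, act_sub, act_one, act_smul] at hrec
  rw [em]
  set S := ∑' k : ℕ, crossMoment Q π G (fun z => act ((1 - α • Abar) ^ k) (e z)) (k + 1)
  have h2 : α • act Abar m = α • (α • S) := by
    have h3 : m - (m - α • act Abar m - α • -(α • S)) = 0 := sub_eq_zero.2 hrec
    rw [smul_neg] at h3
    have h4 : m - (m - α • act Abar m - -(α • α • S)) = α • act Abar m - α • α • S := by abel
    rw [h4] at h3
    exact sub_eq_zero.1 h3
  exact smul_right_injective _ hα h2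

end StationaryMean

/-! ### Uniqueness of the invariant law by synchronous coupling. -/

section Uniqueness

/-- Q need not preserve continuity, so test functions are merely measurable in Y; the J-components
contract, so Lipschitz functions in S are the right tests there. Rectangles with closed second side
suffice, and thickened indicators of closed sets are Lipschitz. -/
theorem ext_of_lipschitz_fiber {Y S : Type*} [MeasurableSpace Y] [MeasurableSpace S]
    [PseudoMetricSpace S] [BorelSpace S] {μ ν : Measure (Y × S)} [IsProbabilityMeasure μ]
    [IsProbabilityMeasure ν]
    (h : ∀ f : Y × S → ℝ, Measurable f → (∀ p, ‖f p‖ ≤ 1) →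
      (∃ L : ℝ, 0 ≤ L ∧ ∀ y s s', ‖f (y, s) - f (y, s')‖ ≤ L * dist s s') →
      ∫ p, f p ∂μ = ∫ p, f p ∂ν) : μ = ν := by
  refine Measure.ext_prod fun {s t} hs ht => ?_
  have hmeas : ∀ (ρ : Measure (Y × S)) (t : Set S), MeasurableSet t →
      ((ρ.restrict (Prod.fst ⁻¹' s)).map Prod.snd) t = ρ (s ×ˢ t) := fun ρ t ht => by
    rw [Measure.map_apply measurable_snd ht, Measure.restrict_apply (measurable_snd ht),
      Set.inter_comm, ← Set.prod_eq]
  have hint : ∀ (ρ : Measure (Y × S)) (g : S → ℝ), Measurable g →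
      ∫ x, g x ∂((ρ.restrict (Prod.fst ⁻¹' s)).map Prod.snd)
        = ∫ p, (Prod.fst ⁻¹' s).indicator (fun p => g p.2) p ∂ρ := fun ρ g hg => by
    rw [integral_map measurable_snd.aemeasurable hg.aestronglyMeasurable,
      integral_indicator (measurable_fst hs)]
  have key : (μ.restrict (Prod.fst ⁻¹' s)).map Prod.snd
      = (ν.restrict (Prod.fst ⁻¹' s)).map Prod.snd := by
    have hclosed : ∀ F : Set S, IsClosed F → ((μ.restrict (Prod.fst ⁻¹' s)).map Prod.snd) F
        = ((ν.restrict (Prod.fst ⁻¹' s)).map Prod.snd) F := fun F hF => by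
      have hpos : ∀ n : ℕ, (0 : ℝ) < 1 / ((n : ℝ) + 1) := fun n => Nat.one_div_pos_of_nat
      have h1 := tendsto_integral_thickenedIndicator_of_isClosed
        ((μ.restrict (Prod.fst ⁻¹' s)).map Prod.snd) hF hpos tendsto_one_div_add_atTop_nhds_zero_nat
      have h2 := tendsto_integral_thickenedIndicator_of_isClosed
        ((ν.restrict (Prod.fst ⁻¹' s)).map Prod.snd) hF hpos tendsto_one_div_add_atTop_nhds_zero_nat
      have h3 : ∀ n : ℕ, ∫ x, (thickenedIndicator (hpos n) F x : ℝ)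
            ∂((μ.restrict (Prod.fst ⁻¹' s)).map Prod.snd)
          = ∫ x, (thickenedIndicator (hpos n) F x : ℝ)
            ∂((ν.restrict (Prod.fst ⁻¹' s)).map Prod.snd) := fun n => by
        have hgm : Measurable fun x => (thickenedIndicator (hpos n) F x : ℝ) := by fun_prop
        rw [hint _ _ hgm, hint _ _ hgm]
        refine h _ ((hgm.comp measurable_snd).indicator (measurable_fst hs)) (fun p => ?_)
          ⟨((1 / ((n : ℝ) + 1)).toNNReal⁻¹ : NNReal), NNReal.coe_nonneg _, fun y x x' => ?_⟩
        · refine (norm_indicator_le_norm_self _ _).trans ?_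
          simpa using thickenedIndicator_le_one (hpos n) F p.2
        · by_cases hy : y ∈ s
          · simp only [Set.indicator, Set.mem_preimage, hy, if_true]
            have := (lipschitzWith_thickenedIndicator (hpos n) F).dist_le_mul x x'
            rwa [NNReal.dist_eq] at this
          · simp only [Set.indicator, Set.mem_preimage, hy, if_false, sub_self, norm_zero]
            positivity
      simp only [h3] at h1
      have h4 := tendsto_nhds_unique h1 h2
      rwa [measureReal_def, measureReal_def, ENNReal.toReal_eq_toReal_iff' (measure_ne_top _ _)
        (measure_ne_top _ _)] at h4
    refine ext_of_generate_finite _ ?_ isPiSystem_isClosed (fun F hF => hclosed F hF)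
      (hclosed _ isClosed_univ)
    rw [BorelSpace.measurable_eq (α := S), borel_eq_generateFrom_isClosed]
  rw [← hmeas μ t ht, ← hmeas ν t ht, key]

variable {Z : Type*} {d : ℕ}

/-- The coupling term in the difference of two trajectories driven by the same noise. -/
noncomputable def couplingSum (B : Matrix (Fin d) (Fin d) ℝ) :
    ℕ → EuclideanSpace ℝ (Fin d) → ℝ
  | 0, _ => 0
  | n + 1, x => ‖B ^ n‖ * ‖x‖ + couplingSum B n (act B x)

theorem couplingSum_nonneg (B : Matrix (Fin d) (Fin d) ℝ) (n : ℕ)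
    (x : EuclideanSpace ℝ (Fin d)) : 0 ≤ couplingSum B n x := by
  induction n generalizing x with
  | zero => exact le_rfl
  | succ n ih => exact add_nonneg (by positivity) (ih _)

/-- `couplingSum B n x` is ∑_{j<n} ‖Bⁿ⁻¹⁻ʲ‖ ‖Bʲx‖; with x replaced by Bᵏx, the exponents in each of
the n terms add up to n + k - 1. For n = 0 the truncated subtraction is harmless, as the factor n
vanishes. -/
theorem couplingSum_le {B : Matrix (Fin d) (Fin d) ℝ} {c r : ℝ} (hc : 0 ≤ c) (hr0 : 0 ≤ r)
    (hB : ∀ n : ℕ, ‖B ^ n‖ ≤ c * r ^ n) (n k : ℕ) (x : EuclideanSpace ℝ (Fin d)) :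
    couplingSum B n (act (B ^ k) x) ≤ n * c ^ 2 * r ^ (n + k - 1) * ‖x‖ := by
  induction n generalizing k with
  | zero => simp [couplingSum]
  | succ n ih =>
    rw [couplingSum, ← act_mul, ← pow_succ']
    have h1 := ih (k + 1)
    have h2 : ‖B ^ n‖ * ‖act (B ^ k) x‖ ≤ (c * r ^ n) * (c * r ^ k * ‖x‖) := by
      gcongr
      · exact hB n
      · exact (norm_act_le _ _).trans (by gcongr; exact hB k)
    rw [show n + (k + 1) - 1 = n + k by omega] at h1
    rw [show n + 1 + k - 1 = n + k by omega]
    refine (add_le_add h2 h1).trans (le_of_eq ?_)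
    push_cast
    ring

theorem tendsto_couplingSum {B : Matrix (Fin d) (Fin d) ℝ} {c r : ℝ} (hc : 0 ≤ c) (hr0 : 0 ≤ r)
    (hr1 : r < 1) (hB : ∀ n : ℕ, ‖B ^ n‖ ≤ c * r ^ n) (x : EuclideanSpace ℝ (Fin d)) :
    Tendsto (fun n => couplingSum B n x) atTop (𝓝 0) := by
  rw [← tendsto_add_atTop_iff_nat 1]
  have h1 : Tendsto (fun n : ℕ => ((n : ℝ) * r ^ n + r ^ n) * (c ^ 2 * ‖x‖)) atTop (𝓝 0) := by
    have := ((tendsto_self_mul_const_pow_of_lt_one hr0 hr1).add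
      (tendsto_pow_atTop_nhds_zero_of_lt_one hr0 hr1)).mul_const (c ^ 2 * ‖x‖)
    simpa using this
  refine squeeze_zero (fun n => couplingSum_nonneg B _ _) (fun n => ?_) h1
  have := couplingSum_le hc hr0 hB (n + 1) 0 x
  rw [pow_zero, act_one] at this
  refine this.trans (le_of_eq ?_)
  simp only [add_zero, Nat.add_sub_cancel]
  push_cast
  ring

theorem tendsto_norm_act_pow {B : Matrix (Fin d) (Fin d) ℝ} {c r : ℝ} (hr0 : 0 ≤ r)
    (hr1 : r < 1) (hB : ∀ n : ℕ, ‖B ^ n‖ ≤ c * r ^ n) (x : EuclideanSpace ℝ (Fin d)) :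
    Tendsto (fun n => ‖act (B ^ n) x‖) atTop (𝓝 0) := by
  have h1 : Tendsto (fun n : ℕ => c * r ^ n * ‖x‖) atTop (𝓝 0) := by
    simpa using ((tendsto_pow_atTop_nhds_zero_of_lt_one hr0 hr1).const_mul c).mul_const ‖x‖
  exact squeeze_zero (fun n => norm_nonneg _)
    (fun n => (norm_act_le _ _).trans (by gcongr; exact hB n)) h1

/-- A bound on the distance after `n` steps of two trajectories driven by the same noise. -/
noncomputable def couplingBound (α C : ℝ) (B : Matrix (Fin d) (Fin d) ℝ) (n : ℕ)
    (x y : EuclideanSpace ℝ (Fin d)) : ℝ :=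
  ‖act (B ^ n) x‖ + ‖act (B ^ n) y‖ + |α| * C * couplingSum B n x

/-- Under a common point z, differences of trajectories evolve by (x, y) ↦ (Bx, By - αMx) with M = G
z. The perturbation αMx, propagated n more steps, is paid for by the first term of `couplingSum B (n
+ 1) x`. -/
theorem couplingBound_step_le {α C : ℝ} {B M : Matrix (Fin d) (Fin d) ℝ} (hM : ‖M‖ ≤ C) (n : ℕ)
    (x y : EuclideanSpace ℝ (Fin d)) :
    couplingBound α C B n (act B x) (act B y - α • act M x) ≤ couplingBound α C B (n + 1) x y := by
  have h1 : ‖act (B ^ n) (act B y - α • act M x)‖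
      ≤ ‖act (B ^ (n + 1)) y‖ + |α| * C * (‖B ^ n‖ * ‖x‖) := by
    rw [act_vec_sub, pow_succ, act_mul]
    refine (norm_sub_le _ _).trans (add_le_add le_rfl ?_)
    rw [act_vec_smul, norm_smul, Real.norm_eq_abs]
    calc |α| * ‖act (B ^ n) (act M x)‖ ≤ |α| * (‖B ^ n‖ * (‖M‖ * ‖x‖)) := by
          gcongr
          exact (norm_act_le _ _).trans (by gcongr; exact norm_act_le _ _)
      _ ≤ |α| * (‖B ^ n‖ * (C * ‖x‖)) := by gcongr
      _ = _ := by ring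
  have h2 : act (B ^ n) (act B x) = act (B ^ (n + 1)) x := by rw [← act_mul, ← pow_succ]
  rw [couplingBound, couplingBound, couplingSum, h2]
  linarith

theorem tendsto_couplingBound {α C : ℝ} {B : Matrix (Fin d) (Fin d) ℝ} {c r : ℝ} (hc : 0 ≤ c)
    (hr0 : 0 ≤ r) (hr1 : r < 1) (hB : ∀ n : ℕ, ‖B ^ n‖ ≤ c * r ^ n)
    (x y : EuclideanSpace ℝ (Fin d)) :
    Tendsto (fun n => couplingBound α C B n x y) atTop (𝓝 0) := by
  simpa [couplingBound] using ((tendsto_norm_act_pow hr0 hr1 hB x).add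
    (tendsto_norm_act_pow hr0 hr1 hB y)).add
    ((tendsto_couplingSum hc hr0 hr1 hB x).const_mul (|α| * C))

variable [MeasurableSpace Z] {Q : Kernel Z Z} [IsMarkovKernel Q]
  {α c r C : ℝ} {Abar : Matrix (Fin d) (Fin d) ℝ} {G : Z → Matrix (Fin d) (Fin d) ℝ}
  {e : Z → EuclideanSpace ℝ (Fin d)}

theorem integral_kernelJ1 (hG : ∀ i j, Measurable fun z => G z i j) (he : Measurable e)
    {f : Z × EuclideanSpace ℝ (Fin d) × EuclideanSpace ℝ (Fin d) → ℝ} (hf : Measurable f)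
    (y : Z × EuclideanSpace ℝ (Fin d) × EuclideanSpace ℝ (Fin d)) :
    ∫ y', f y' ∂(kernelJ1 Q α Abar hG he y) = ∫ z, f (z, stepJ α Abar G e y) ∂(Q y.1) := by
  rw [kernelJ1_apply, integral_map measurable_prodMk_right.aemeasurable hf.aestronglyMeasurable]

theorem invariant_map_fst (hG : ∀ i j, Measurable fun z => G z i j) (he : Measurable e)
    {μ : Measure (Z × EuclideanSpace ℝ (Fin d) × EuclideanSpace ℝ (Fin d))}
    (hμ : (kernelJ1 Q α Abar hG he).Invariant μ) : Q.Invariant (μ.map Prod.fst) := by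
  refine Measure.ext_of_lintegral _ fun f hf => ?_
  rw [Measure.lintegral_bind (Kernel.aemeasurable _) hf.aemeasurable,
    lintegral_map hf.lintegral_kernel measurable_fst, lintegral_map hf measurable_fst]
  conv_rhs => rw [← hμ.def]
  have hf1 : Measurable fun y : Z × EuclideanSpace ℝ (Fin d) × EuclideanSpace ℝ (Fin d) => f y.1 :=
    hf.comp measurable_fst
  rw [Measure.lintegral_bind (Kernel.aemeasurable _) hf1.aemeasurable]
  refine lintegral_congr fun y => ?_
  rw [kernelJ1_apply, lintegral_map hf1 measurable_prodMk_right]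

/-- The kernel of `(Z, J⁽⁰⁾, J⁽¹⁾)` has at most one invariant probability measure. -/
theorem kernelJ1_invariant_unique {π : Measure Z} [IsProbabilityMeasure π] {t : ℕ}
    (hπ : Q.Invariant π) (ht : 1 ≤ t) (hmix : HasMixingTime Q t)
    (hG : ∀ i j, Measurable fun z => G z i j) (he : Measurable e) (hGb : ∀ z, ‖G z‖ ≤ C)
    (hc : 0 ≤ c) (hr0 : 0 ≤ r) (hr1 : r < 1) (hB : ∀ n : ℕ, ‖(1 - α • Abar) ^ n‖ ≤ c * r ^ n)
    {μ ν : Measure (Z × EuclideanSpace ℝ (Fin d) × EuclideanSpace ℝ (Fin d))}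
    [IsProbabilityMeasure μ] [IsProbabilityMeasure ν]
    (hμ : (kernelJ1 Q α Abar hG he).Invariant μ) (hν : (kernelJ1 Q α Abar hG he).Invariant ν) :
    μ = ν := by
  refine ext_of_lipschitz_fiber fun f hf hf1 hfL => ?_
  obtain ⟨L, hL0, hL⟩ := hfL
  set K := kernelJ1 Q α Abar hG he with hK
  set fn : ℕ → Z × EuclideanSpace ℝ (Fin d) × EuclideanSpace ℝ (Fin d) → ℝ :=
    fun n => (fun g y => ∫ y', g y' ∂(K y))^[n] f with hfn
  have hfs : ∀ n, fn (n + 1) = fun y => ∫ y', fn n y' ∂(K y) := fun n => by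
    simp only [hfn, Function.iterate_succ_apply']
  have hfm : ∀ n, Measurable (fn n) := fun n => by
    induction n with
    | zero => exact hf
    | succ n ih =>
      rw [hfs]
      exact (ih.stronglyMeasurable.integral_kernel).measurable
  have hfb : ∀ n y, ‖fn n y‖ ≤ 1 := fun n => by
    induction n with
    | zero => exact hf1
    | succ n ih =>
      intro y
      rw [hfs]
      exact norm_integral_le_of_forall ih
  -- From a common z both integrals are against Q(z, ·), so they can be compared point by point with
  -- the same next point.
  have hfd : ∀ n z x y x' y', ‖fn n (z, x, y) - fn n (z, x', y')‖
      ≤ L * couplingBound α C (1 - α • Abar) n (x - x') (y - y') := fun n => by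
    induction n with
    | zero =>
      intro z x y x' y'
      refine (hL z (x, y) (x', y')).trans ?_
      gcongr
      rw [couplingBound, couplingSum, pow_zero, act_one, act_one, mul_zero, add_zero,
        Prod.dist_eq, dist_eq_norm, dist_eq_norm]
      exact max_le_add_of_nonneg (norm_nonneg _) (norm_nonneg _)
    | succ n ih =>
      intro z x y x' y'
      rw [hfs]
      simp only
      rw [integral_kernelJ1 hG he (hfm n), integral_kernelJ1 hG he (hfm n), ← integral_sub]
      · refine norm_integral_le_of_forall fun z' => ?_
        refine (ih z' _ _ _ _).trans ?_
        gcongr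
        refine le_trans (le_of_eq ?_) (couplingBound_step_le (hGb z) n (x - x') (y - y'))
        simp only [act_vec_sub, smul_sub]
        congr 1 <;> abel
      · exact integrable_of_bound ((hfm n).comp measurable_prodMk_right).stronglyMeasurable
          fun z' => hfb n _
      · exact integrable_of_bound ((hfm n).comp measurable_prodMk_right).stronglyMeasurable
          fun z' => hfb n _
  have hm0 : ∀ n, Measurable fun z : Z => fn n (z, 0, 0) := fun n =>
    (hfm n).comp measurable_prodMk_right
  -- The integral of f against an invariant ρ equals that of Kⁿf, which asymptotically forgets its
  -- J-arguments. It is therefore the limit of a quantity depending on ρ only through its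
  -- Z-marginal, which is π.
  have main : ∀ (ρ : Measure (Z × EuclideanSpace ℝ (Fin d) × EuclideanSpace ℝ (Fin d)))
      [IsProbabilityMeasure ρ], K.Invariant ρ →
      Tendsto (fun n => ∫ z, fn n (z, 0, 0) ∂π) atTop (𝓝 (∫ y, f y ∂ρ)) := by
    intro ρ _ hρ
    have hfst : ρ.map Prod.fst = π := by
      have : IsProbabilityMeasure (ρ.map Prod.fst) :=
        Measure.isProbabilityMeasure_map measurable_fst.aemeasurable
      exact invariant_unique hπ ht hmix (invariant_map_fst hG he hρ)
    have hint : ∀ n, ∫ y, fn n y ∂ρ = ∫ y, f y ∂ρ := fun n => by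
      induction n with
      | zero => rfl
      | succ n ih =>
        rw [← ih, hfs, ← integral_comp_measure K ρ (hfm n).stronglyMeasurable (hfb n), hρ.def]
    have e1 : ∀ n, ∫ z, fn n (z, 0, 0) ∂π
        = ∫ y, f y ∂ρ - ∫ y, (fn n y - fn n (y.1, 0, 0)) ∂ρ := fun n => by
      have hi0 : Integrable (fun y : Z × EuclideanSpace ℝ (Fin d) × EuclideanSpace ℝ (Fin d) =>
          fn n (y.1, 0, 0)) ρ :=
        integrable_of_bound ((hm0 n).comp measurable_fst).stronglyMeasurable fun y => hfb n _
      rw [integral_sub (integrable_of_bound (hfm n).stronglyMeasurable (hfb n)) hi0, hint n, ← hfst,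
        integral_map measurable_fst.aemeasurable (hm0 n).aestronglyMeasurable]
      ring
    have e2 : Tendsto (fun n => ∫ y, (fn n y - fn n (y.1, 0, 0)) ∂ρ) atTop
        (𝓝 (∫ _, (0 : ℝ) ∂ρ)) := by
      refine tendsto_integral_of_dominated_convergence (fun _ => (2 : ℝ)) (fun n => ?_)
        (integrable_const _) (fun n => Eventually.of_forall fun y => ?_)
        (Eventually.of_forall fun y => ?_)
      · exact ((hfm n).sub ((hm0 n).comp measurable_fst)).aestronglyMeasurable
      · refine (norm_sub_le _ _).trans ?_
        linarith [hfb n y, hfb n (y.1, 0, 0)]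
      · rw [tendsto_zero_iff_norm_tendsto_zero]
        have h3 := (tendsto_couplingBound (α := α) (C := C) hc hr0 hr1 hB (y.2.1 - 0)
          (y.2.2 - 0)).const_mul L
        rw [mul_zero] at h3
        exact squeeze_zero (fun n => norm_nonneg _) (fun n => hfd n y.1 y.2.1 y.2.2 0 0) h3
    rw [integral_zero] at e2
    simp only [e1]
    simpa using e2.const_sub (∫ y, f y ∂ρ)
  exact tendsto_nhds_unique (main μ hμ) (main ν hν)

end Uniqueness

/-! ### Affine recursions with a stable matrix. -/

section Recursion

variable {d : ℕ} {B : Matrix (Fin d) (Fin d) ℝ}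

theorem eq_of_affine_recursion {v g : ℕ → EuclideanSpace ℝ (Fin d)}
    (h : ∀ n, v (n + 1) = act B (v n) + g n) (n : ℕ) :
    v n = act (B ^ n) (v 0) + ∑ k ∈ Finset.range n, act (B ^ k) (g (n - 1 - k)) := by
  induction n with
  | zero => simp [act_one]
  | succ n ih =>
    rw [h, Finset.sum_range_succ', pow_zero, act_one, pow_succ', act_mul]
    conv_lhs => rw [ih]
    have h1 : act B (act (B ^ n) (v 0) + ∑ k ∈ Finset.range n, act (B ^ k) (g (n - 1 - k)))
        = act B (act (B ^ n) (v 0))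
          + ∑ k ∈ Finset.range n, act (B ^ (k + 1)) (g (n + 1 - 1 - (k + 1))) := by
      rw [act, map_add, map_sum]
      congr 1
      refine Finset.sum_congr rfl fun k _ => ?_
      rw [pow_succ', act_mul, show n + 1 - 1 - (k + 1) = n - 1 - k by omega]
    rw [h1, add_assoc]
    rfl

/-- Tannery's theorem for the truncated sums `∑_{k < n} f n k`. -/
theorem tendsto_sum_range_of_dominated {E : Type*} [NormedAddCommGroup E] [CompleteSpace E]
    {f : ℕ → ℕ → E} {g : ℕ → E} {b : ℕ → ℝ} (hb : Summable b)
    (hfg : ∀ k, Tendsto (fun n => f n k) atTop (𝓝 (g k))) (hfb : ∀ n k, ‖f n k‖ ≤ b k) :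
    Tendsto (fun n => ∑ k ∈ Finset.range n, f n k) atTop (𝓝 (∑' k, g k)) := by
  have e : ∀ n, ∑ k ∈ Finset.range n, f n k = ∑' k, if k < n then f n k else 0 := fun n => by
    rw [tsum_eq_sum (s := Finset.range n) fun k hk => if_neg fun h => hk (Finset.mem_range.2 h)]
    exact Finset.sum_congr rfl fun k hk => (if_pos (Finset.mem_range.1 hk)).symm
  simp only [e]
  refine tendsto_tsum_of_dominated_convergence hb (fun k => ?_) (Eventually.of_forall fun n k => ?_)
  · refine (hfg k).congr' ?_
    filter_upwards [eventually_gt_atTop k] with n hn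
    rw [if_pos hn]
  · split_ifs
    · exact hfb n k
    · rw [norm_zero]
      exact (norm_nonneg _).trans (hfb 0 k)

/-- The solution is Bⁿ v 0 plus a convolution of the summable powers of B with a bounded null
sequence. -/
theorem tendsto_zero_of_affine_recursion {c r M : ℝ} (hr0 : 0 ≤ r) (hr1 : r < 1)
    (hB : ∀ n : ℕ, ‖B ^ n‖ ≤ c * r ^ n) {v g : ℕ → EuclideanSpace ℝ (Fin d)}
    (h : ∀ n, v (n + 1) = act B (v n) + g n) (hg : Tendsto g atTop (𝓝 0)) (hM : ∀ n, ‖g n‖ ≤ M) :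
    Tendsto v atTop (𝓝 0) := by
  have h1 : Tendsto (fun n => act (B ^ n) (v 0)) atTop (𝓝 0) :=
    tendsto_zero_iff_norm_tendsto_zero.2 (tendsto_norm_act_pow hr0 hr1 hB (v 0))
  have h2 : Tendsto (fun n => ∑ k ∈ Finset.range n, act (B ^ k) (g (n - 1 - k))) atTop
      (𝓝 (∑' _ : ℕ, (0 : EuclideanSpace ℝ (Fin d)))) := by
    refine tendsto_sum_range_of_dominated (summable_geom_bound hr0 hr1 (c * M)) (fun k => ?_)
      fun n k => norm_act_pow_le hB (u := fun k => g (n - 1 - k)) (fun _ => hM _) k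
    have h3 : Tendsto (fun n : ℕ => g (n - 1 - k)) atTop (𝓝 0) :=
      hg.comp ((tendsto_sub_atTop_nat k).comp (tendsto_sub_atTop_nat 1))
    have h4 := ((Matrix.toEuclideanCLM (n := Fin d) (𝕜 := ℝ) (B ^ k)).continuous.tendsto 0).comp h3
    rwa [map_zero] at h4
  rw [tsum_zero] at h2
  have h5 := h1.add h2
  rw [add_zero] at h5
  exact h5.congr fun n => (eq_of_affine_recursion h n).symm

end Recursion

/-! ### Pathwise bounds and the explicit form of J⁽⁰⁾. -/

section Pathwise

variable {Z : Type*} {d : ℕ} {α C D : ℝ} {Abar : Matrix (Fin d) (Fin d) ℝ}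
  {G : Z → Matrix (Fin d) (Fin d) ℝ} {e : Z → EuclideanSpace ℝ (Fin d)}

/-- A bound depending on n is enough: it only serves for integrability. -/
theorem exists_norm_J0_le (heb : ∀ z, ‖e z‖ ≤ D) (n : ℕ) :
    ∃ K : ℝ, ∀ w, ‖J0 α Abar e w n‖ ≤ K := by
  induction n with
  | zero => exact ⟨0, fun w => by simp [J0]⟩
  | succ n ih =>
    obtain ⟨K, hK⟩ := ih
    refine ⟨‖1 - α • Abar‖ * K + |α| * D, fun w => ?_⟩
    refine (norm_sub_le _ _).trans (add_le_add (norm_act_le_of_le le_rfl (hK w)) ?_)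
    rw [norm_smul, Real.norm_eq_abs]
    gcongr
    exact heb _

theorem exists_norm_J1_le (heb : ∀ z, ‖e z‖ ≤ D)
    (hGb : ∀ z, ‖G z‖ ≤ C) (n : ℕ) :
    ∃ K : ℝ, ∀ w, ‖J1 α Abar G e w n‖ ≤ K := by
  induction n with
  | zero => exact ⟨0, fun w => by simp [J1]⟩
  | succ n ih =>
    obtain ⟨K, hK⟩ := ih
    obtain ⟨K', hK'⟩ := exists_norm_J0_le (α := α) (Abar := Abar) heb n
    refine ⟨‖1 - α • Abar‖ * K + |α| * (C * K'), fun w => ?_⟩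
    refine (norm_sub_le _ _).trans (add_le_add (norm_act_le_of_le le_rfl (hK w)) ?_)
    rw [norm_smul, Real.norm_eq_abs]
    gcongr
    exact norm_act_le_of_le (hGb _) (hK' w)

theorem act_J0_eq_sum (M : Matrix (Fin d) (Fin d) ℝ) (w : ℕ → Z) (n : ℕ) :
    act M (J0 α Abar e w n)
      = -(α • ∑ k ∈ Finset.range n, act M (act ((1 - α • Abar) ^ k) (e (w (n - k))))) := by
  have h := eq_of_affine_recursion (B := 1 - α • Abar) (v := J0 α Abar e w)
    (g := fun n => -(α • e (w (n + 1)))) (fun n => sub_eq_add_neg _ _) n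
  rw [h]
  have h0 : act ((1 - α • Abar) ^ n) (J0 α Abar e w 0) = 0 := map_zero _
  rw [h0, zero_add, Finset.smul_sum, ← Finset.sum_neg_distrib]
  refine (map_sum _ _ _).trans (Finset.sum_congr rfl fun k hk => ?_)
  rw [show n - 1 - k + 1 = n - k by have := Finset.mem_range.1 hk; omega]
  simp only [act, map_neg, map_smul]

end Pathwise

/-! ### Convergence of the means from an arbitrary initial law. -/

section MarkovChain

variable {Z : Type*} [MeasurableSpace Z] {Q : Kernel Z Z} [IsMarkovKernel Q]
  {Ω : Type*} [MeasurableSpace Ω] {P : Measure Ω} [IsProbabilityMeasure P] {X : ℕ → Ω → Z}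

/-- Conditionally on the whole past, the next point depends on the last one only, so the coordinate
i can be carried along unchanged. -/
theorem IsMarkovChain.map_pair (h : IsMarkovChain P Q X) (i k : ℕ) :
    P.map (fun ω => (X i ω, X (i + k) ω)) = P.map (X i) ⊗ₘ (Q ^ k) := by
  have : IsProbabilityMeasure (P.map (X i)) :=
    Measure.isProbabilityMeasure_map (h.1 i).aemeasurable
  have hm : ∀ k, Measurable fun ω => (X i ω, X (i + k) ω) := fun k => (h.1 i).prodMk (h.1 (i + k))
  induction k with
  | zero =>
    refine Measure.ext_of_lintegral _ fun f hf => ?_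
    rw [show Q ^ 0 = Kernel.id from rfl, Measure.lintegral_compProd hf, lintegral_map hf (hm 0),
      lintegral_map hf.lintegral_kernel_prod_right' (h.1 i)]
    refine lintegral_congr fun ω => ?_
    exact (lintegral_dirac' (X i ω) (hf.comp measurable_prodMk_left)).symm
  | succ k ih =>
    refine Measure.ext_of_lintegral _ fun f hf => ?_
    obtain ⟨hq, hq'⟩ := lintegral_compProd_pow_succ (Q := Q) (P.map (X i)) k hf
    have hik : i ∈ Finset.Iic (i + k) := Finset.mem_Iic.2 (Nat.le_add_right i k)
    have hpast : Measurable fun ω (j : Finset.Iic (i + k)) => X j ω :=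
      measurable_pi_lambda _ fun j => h.1 j
    have hprob : IsProbabilityMeasure (P.map fun ω (j : Finset.Iic (i + k)) => X j ω) :=
      Measure.isProbabilityMeasure_map hpast.aemeasurable
    have hF : Measurable fun q : (Finset.Iic (i + k) → Z) × Z => f (q.1 ⟨i, hik⟩, q.2) :=
      hf.comp (((measurable_pi_apply _).comp measurable_fst).prodMk measurable_snd)
    have hlaw := (h.2 (i + k)).map_eq
    have hpm : Measurable fun ω => ((fun j : Finset.Iic (i + k) => X j ω), X (i + k + 1) ω) :=
      hpast.prodMk (h.1 _)
    calc ∫⁻ p, f p ∂(P.map fun ω => (X i ω, X (i + (k + 1)) ω))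
        = ∫⁻ ω, f (X i ω, X (i + k + 1) ω) ∂P := lintegral_map hf (hm (k + 1))
      _ = ∫⁻ q, f (q.1 ⟨i, hik⟩, q.2)
            ∂(P.map fun ω => ((fun j : Finset.Iic (i + k) => X j ω), X (i + k + 1) ω)) :=
          (lintegral_map hF hpm).symm
      _ = ∫⁻ ω, ∫⁻ z, f (X i ω, z) ∂(Q (X (i + k) ω)) ∂P := by
          rw [hlaw, Measure.lintegral_compProd hF,
            lintegral_map hF.lintegral_kernel_prod_right' hpast]
          rfl
      _ = ∫⁻ p, ∫⁻ z, f (p.1, z) ∂(Q p.2) ∂(P.map (X i) ⊗ₘ (Q ^ k)) := by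
          rw [← ih, lintegral_map hq (hm k)]
      _ = _ := hq'

theorem IsMarkovChain.map_eq (h : IsMarkovChain P Q X) (k : ℕ) :
    P.map (X k) = (Q ^ k : Kernel Z Z) ∘ₘ (P.map (X 0)) := by
  have : IsProbabilityMeasure (P.map (X 0)) :=
    Measure.isProbabilityMeasure_map (h.1 0).aemeasurable
  have h1 := h.map_pair 0 k
  rw [← Measure.snd_compProd, ← h1, Measure.snd, Measure.map_map measurable_snd
    ((h.1 0).prodMk (h.1 _))]
  simp only [Function.comp_def, zero_add]

variable {d : ℕ} {α c r C D : ℝ} {Abar : Matrix (Fin d) (Fin d) ℝ}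
  {G : Z → Matrix (Fin d) (Fin d) ℝ} {e : Z → EuclideanSpace ℝ (Fin d)}

theorem measurable_J0 (hX : ∀ n, Measurable (X n)) (he : Measurable e) (n : ℕ) :
    Measurable fun ω => J0 α Abar e (fun k => X k ω) n := by
  induction n with
  | zero => exact measurable_const
  | succ n ih =>
    exact (measurable_act_const _ ih).sub ((he.comp (hX (n + 1))).const_smul α)

theorem measurable_act_J0 (hX : ∀ n, Measurable (X n)) (he : Measurable e)
    (hG : ∀ i j, Measurable fun z => G z i j) (n : ℕ) :
    Measurable fun ω => act (G (X (n + 1) ω)) (J0 α Abar e (fun k => X k ω) n) :=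
  measurable_act (M := fun ω => G (X (n + 1) ω)) (fun i j => (hG i j).comp (hX (n + 1)))
    (measurable_J0 hX he n)

theorem measurable_J1 (hX : ∀ n, Measurable (X n)) (he : Measurable e)
    (hG : ∀ i j, Measurable fun z => G z i j) (n : ℕ) :
    Measurable fun ω => J1 α Abar G e (fun k => X k ω) n := by
  induction n with
  | zero => exact measurable_const
  | succ n ih =>
    exact (measurable_act_const _ ih).sub ((measurable_act_J0 hX he hG n).const_smul α)

theorem integrable_J1 (hX : ∀ n, Measurable (X n)) (he : Measurable e)
    (hG : ∀ i j, Measurable fun z => G z i j) (heb : ∀ z, ‖e z‖ ≤ D)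
    (hGb : ∀ z, ‖G z‖ ≤ C) (n : ℕ) :
    Integrable (fun ω => J1 α Abar G e (fun k => X k ω) n) P := by
  obtain ⟨K, hK⟩ := exists_norm_J1_le (α := α) (Abar := Abar) heb hGb n
  exact integrable_of_bound (measurable_J1 hX he hG n).stronglyMeasurable fun ω => hK _

theorem integrable_act_J0 (hX : ∀ n, Measurable (X n)) (he : Measurable e)
    (hG : ∀ i j, Measurable fun z => G z i j) (heb : ∀ z, ‖e z‖ ≤ D)
    (hGb : ∀ z, ‖G z‖ ≤ C) (n : ℕ) :
    Integrable (fun ω => act (G (X (n + 1) ω)) (J0 α Abar e (fun k => X k ω) n)) P := by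
  obtain ⟨K, hK⟩ := exists_norm_J0_le (α := α) (Abar := Abar) heb n
  exact integrable_of_bound (measurable_act_J0 hX he hG n).stronglyMeasurable
    fun ω => norm_act_le_of_le (hGb _) (hK _)

/-- In the expansion of J⁽⁰⁾, X (n - k) and X (n + 1) are k + 1 steps apart, and X (n - k) has the
initial law moved by n - k steps. -/
theorem IsMarkovChain.integral_act_J0 (h : IsMarkovChain P Q X) (he : Measurable e)
    (hG : ∀ i j, Measurable fun z => G z i j) (heb : ∀ z, ‖e z‖ ≤ D)
    (hGb : ∀ z, ‖G z‖ ≤ C) (n : ℕ) :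
    ∫ ω, act (G (X (n + 1) ω)) (J0 α Abar e (fun k => X k ω) n) ∂P
      = -(α • ∑ k ∈ Finset.range n, crossMoment Q ((Q ^ (n - k) : Kernel Z Z) ∘ₘ (P.map (X 0))) G
          (fun z => act ((1 - α • Abar) ^ k) (e z)) (k + 1)) := by
  have hm : ∀ k : ℕ, Measurable fun p : Z × Z => act (G p.2) (act ((1 - α • Abar) ^ k) (e p.1)) :=
    fun k => (stronglyMeasurable_act_prod (e := fun z => act ((1 - α • Abar) ^ k) (e z)) hG
      (measurable_act_const _ he)).measurable
  have hmω : ∀ k : ℕ, Measurable fun ω =>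
      act (G (X (n + 1) ω)) (act ((1 - α • Abar) ^ k) (e (X (n - k) ω))) := fun k =>
    measurable_act (M := fun ω => G (X (n + 1) ω)) (fun i j => (hG i j).comp (h.1 (n + 1)))
      (measurable_act_const _ (he.comp (h.1 (n - k))))
  have hint : ∀ k ∈ Finset.range n, Integrable (fun ω =>
      act (G (X (n + 1) ω)) (act ((1 - α • Abar) ^ k) (e (X (n - k) ω)))) P := fun k _ =>
    integrable_of_bound (hmω k).stronglyMeasurable fun ω =>
      norm_act_le_of_le (hGb _) (norm_act_le_of_le le_rfl (heb _))
  simp only [act_J0_eq_sum]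
  rw [integral_neg, integral_smul, integral_finsetSum _ hint]
  congr 2
  refine Finset.sum_congr rfl fun k hk => ?_
  have hk' := Finset.mem_range.1 hk
  have hpair := h.map_pair (n - k) (k + 1)
  rw [show n - k + (k + 1) = n + 1 by omega] at hpair
  rw [crossMoment, ← h.map_eq, ← hpair, integral_map ((h.1 _).prodMk (h.1 _)).aemeasurable
    (hm k).aestronglyMeasurable]

theorem norm_crossMoment_le_mul (hGb : ∀ z, ‖G z‖ ≤ C) (heb : ∀ z, ‖e z‖ ≤ D) (μ : Measure Z)
    [IsProbabilityMeasure μ] (k : ℕ) : ‖crossMoment Q μ G e k‖ ≤ C * D := by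
  rw [crossMoment]
  exact norm_integral_le_of_forall fun p => norm_act_le_of_le (hGb p.2) (heb p.1)

theorem norm_crossMoment_pow_le (heb : ∀ z, ‖e z‖ ≤ D) (hGb : ∀ z, ‖G z‖ ≤ C)
    (hB : ∀ n : ℕ, ‖(1 - α • Abar) ^ n‖ ≤ c * r ^ n) (μ : Measure Z) [IsProbabilityMeasure μ]
    (k l : ℕ) :
    ‖crossMoment Q μ G (fun z => act ((1 - α • Abar) ^ k) (e z)) l‖ ≤ C * c * D * r ^ k := by
  have heB : ∀ z, ‖act ((1 - α • Abar) ^ k) (e z)‖ ≤ c * r ^ k * D := fun z =>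
    norm_act_le_of_le (hB k) (heb z)
  exact (norm_crossMoment_le_mul hGb heB μ l).trans (le_of_eq (by ring))

/-- For fixed k the law after n - k steps tends to π; domination comes from the decay of Bᵏ alone,
so Tannery's theorem applies. -/
theorem tendsto_sum_crossMoment {π : Measure Z} [IsProbabilityMeasure π] {t : ℕ}
    (hπ : Q.Invariant π) (ht : 1 ≤ t) (hmix : HasMixingTime Q t)
    (he : Measurable e) (hG : ∀ i j, Measurable fun z => G z i j) (heb : ∀ z, ‖e z‖ ≤ D)
    (hGb : ∀ z, ‖G z‖ ≤ C) (hr0 : 0 ≤ r) (hr1 : r < 1)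
    (hB : ∀ n : ℕ, ‖(1 - α • Abar) ^ n‖ ≤ c * r ^ n) (μ : Measure Z) [IsProbabilityMeasure μ] :
    Tendsto (fun n : ℕ => ∑ k ∈ Finset.range n, crossMoment Q ((Q ^ (n - k) : Kernel Z Z) ∘ₘ μ) G
      (fun z => act ((1 - α • Abar) ^ k) (e z)) (k + 1)) atTop
      (𝓝 (∑' k : ℕ, crossMoment Q π G (fun z => act ((1 - α • Abar) ^ k) (e z)) (k + 1))) := by
  refine tendsto_sum_range_of_dominated
    (f := fun n k => crossMoment Q ((Q ^ (n - k) : Kernel Z Z) ∘ₘ μ) G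
      (fun z => act ((1 - α • Abar) ^ k) (e z)) (k + 1))
    (summable_geom_bound hr0 hr1 (C * c * D)) (fun k => ?_)
    fun n k => norm_crossMoment_pow_le heb hGb hB _ k (k + 1)
  have heBm : Measurable fun z => act ((1 - α • Abar) ^ k) (e z) := measurable_act_const _ he
  have heB : ∀ z, ‖act ((1 - α • Abar) ^ k) (e z)‖ ≤ c * r ^ k * D := fun z =>
    norm_act_le_of_le (hB k) (heb z)
  exact (tendsto_crossMoment hπ ht hmix hG heBm hGb heB μ (k + 1)).comp (tendsto_sub_atTop_nat k)

theorem integral_J1_succ (hX : ∀ n, Measurable (X n)) (he : Measurable e)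
    (hG : ∀ i j, Measurable fun z => G z i j) (heb : ∀ z, ‖e z‖ ≤ D)
    (hGb : ∀ z, ‖G z‖ ≤ C) (n : ℕ) :
    ∫ ω, J1 α Abar G e (fun k => X k ω) (n + 1) ∂P
      = act (1 - α • Abar) (∫ ω, J1 α Abar G e (fun k => X k ω) n ∂P)
        - α • ∫ ω, act (G (X (n + 1) ω)) (J0 α Abar e (fun k => X k ω) n) ∂P := by
  have hi1 : Integrable (fun ω => J1 α Abar G e (fun k => X k ω) n) P :=
    integrable_J1 hX he hG heb hGb n
  have hiB : Integrable (fun ω => act (1 - α • Abar) (J1 α Abar G e (fun k => X k ω) n)) P :=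
    ContinuousLinearMap.integrable_comp _ hi1
  have hiα : Integrable (fun ω =>
      α • act (G (X (n + 1) ω)) (J0 α Abar e (fun k => X k ω) n)) P :=
    (integrable_act_J0 hX he hG heb hGb n).smul α
  have h2 : act (1 - α • Abar) (∫ ω, J1 α Abar G e (fun k => X k ω) n ∂P)
      = ∫ ω, act (1 - α • Abar) (J1 α Abar G e (fun k => X k ω) n) ∂P :=
    (ContinuousLinearMap.integral_comp_comm _ hi1).symm
  rw [h2, ← integral_smul, ← integral_sub hiB hiα]
  rfl

/-- Ām = αL says that m is fixed by v ↦ (1 - αĀ)v + α²L, so v - m solves the recursion with a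
vanishing forcing. -/
theorem tendsto_of_affine_recursion (hr0 : 0 ≤ r) (hr1 : r < 1)
    (hB : ∀ n : ℕ, ‖(1 - α • Abar) ^ n‖ ≤ c * r ^ n) {v S : ℕ → EuclideanSpace ℝ (Fin d)}
    {m L : EuclideanSpace ℝ (Fin d)} {M : ℝ}
    (hv : ∀ n, v (n + 1) = act (1 - α • Abar) (v n) + (α * α) • S n) (hm : act Abar m = α • L)
    (hS : Tendsto S atTop (𝓝 L)) (hM : ∀ n, ‖S n‖ ≤ M) : Tendsto v atTop (𝓝 m) := by
  have hrec : ∀ n, v (n + 1) - m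
      = act (1 - α • Abar) (v n - m) + (α * α) • (S n - L) := fun n => by
    rw [hv, act_vec_sub, act_sub _ _ m, act_one, act_smul, hm, smul_smul, smul_sub]
    abel
  have h0 := tendsto_zero_of_affine_recursion (v := fun n => v n - m)
    (g := fun n => (α * α) • (S n - L)) (M := |α * α| * (M + ‖L‖)) hr0 hr1 hB hrec ?_ fun n => ?_
  · simpa using h0.add_const m
  · have := (hS.sub_const L).const_smul (α * α)
    rwa [sub_self, smul_zero] at this
  · rw [norm_smul, Real.norm_eq_abs]
    exact mul_le_mul_of_nonneg_left ((norm_sub_le _ _).trans (by gcongr; exact hM n)) (abs_nonneg _)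

/-- Convergence of the means of `J⁽¹⁾` along a chain with arbitrary initial law. -/
theorem IsMarkovChain.tendsto_integral_J1 {π : Measure Z} [IsProbabilityMeasure π] {t : ℕ}
    (h : IsMarkovChain P Q X) (hπ : Q.Invariant π) (ht : 1 ≤ t) (hmix : HasMixingTime Q t)
    (he : Measurable e) (hG : ∀ i j, Measurable fun z => G z i j) (heb : ∀ z, ‖e z‖ ≤ D)
    (hGb : ∀ z, ‖G z‖ ≤ C) (hr0 : 0 ≤ r) (hr1 : r < 1)
    (hB : ∀ n : ℕ, ‖(1 - α • Abar) ^ n‖ ≤ c * r ^ n) {m : EuclideanSpace ℝ (Fin d)}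
    (hm : act Abar m
      = α • ∑' k : ℕ, crossMoment Q π G (fun z => act ((1 - α • Abar) ^ k) (e z)) (k + 1)) :
    Tendsto (fun n => ∫ ω, J1 α Abar G e (fun k => X k ω) n ∂P) atTop (𝓝 m) := by
  have : IsProbabilityMeasure (P.map (X 0)) :=
    Measure.isProbabilityMeasure_map (h.1 0).aemeasurable
  have hlim := tendsto_sum_crossMoment hπ ht hmix he hG heb hGb hr0 hr1 hB (P.map (X 0))
  obtain ⟨M, hM⟩ := hlim.norm.bddAbove_range
  refine tendsto_of_affine_recursion hr0 hr1 hB (fun n => ?_) hm hlim fun n => hM ⟨n, rfl⟩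
  rw [integral_J1_succ h.1 he hG heb hGb, h.integral_act_J0 he hG heb hGb n, smul_neg, smul_smul,
    sub_neg_eq_add]

end MarkovChain

/-! ### Scalar estimates: mixing against growth. -/

section Geometric

/-- Moving the ratio to the left leaves the factor (1 + x)(1 + 1/t) per step. Over t steps it costs
at most e^(xt+1) ≤ e^(9/8) ≤ 4, which one factor 1/4 repays; the 4 on the right covers an incomplete
block. -/
theorem quarter_pow_div_mul_le {x : ℝ} {t : ℕ} (hx : 0 ≤ x) (ht : 1 ≤ t) (hxt : x * t ≤ 1 / 8)
    (k : ℕ) : (1 / 4 : ℝ) ^ (k / t) * (1 + x) ^ k ≤ 4 * ((t : ℝ) / (t + 1)) ^ k := by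
  have ht0 : (0 : ℝ) < t := by exact_mod_cast ht
  set y : ℝ := (1 + x) * (1 + (t : ℝ)⁻¹) with hy
  have hy1 : 1 ≤ y := by
    rw [hy]
    nlinarith [inv_pos.2 ht0, mul_nonneg hx (inv_pos.2 ht0).le]
  have hyt : y ^ t ≤ 4 := by
    have h1 : y ≤ Real.exp (x + (t : ℝ)⁻¹) := by
      rw [Real.exp_add]
      refine mul_le_mul ?_ ?_ (by positivity) (Real.exp_pos _).le
      · linarith [Real.add_one_le_exp x]
      · linarith [Real.add_one_le_exp (t : ℝ)⁻¹]
    have h2 : Real.exp (9 / 8) ≤ 4 := by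
      have h3 : Real.exp (9 / 8) * Real.exp (-(1 / 8)) = Real.exp 1 := by
        rw [← Real.exp_add]; norm_num
      have h4 := Real.add_one_le_exp (-(1 / 8) : ℝ)
      have h5 := Real.exp_one_lt_d9
      nlinarith [Real.exp_pos (9 / 8 : ℝ)]
    calc y ^ t ≤ Real.exp (x + (t : ℝ)⁻¹) ^ t := pow_le_pow_left₀ (by linarith) h1 t
      _ = Real.exp (x * t + 1) := by
        rw [← Real.exp_nat_mul]; congr 1; field_simp
      _ ≤ Real.exp (9 / 8) := Real.exp_le_exp.2 (by linarith)
      _ ≤ 4 := h2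
  have hk : y ^ k ≤ 4 ^ (k / t + 1) :=
    calc y ^ k ≤ y ^ (t * (k / t + 1)) :=
          pow_le_pow_right₀ hy1 (Nat.lt_mul_div_succ k (by omega)).le
      _ = (y ^ t) ^ (k / t + 1) := pow_mul _ _ _
      _ ≤ 4 ^ (k / t + 1) := pow_le_pow_left₀ (by positivity) hyt _
  have hx' : (1 + x) ^ k = y ^ k * ((t : ℝ) / (t + 1)) ^ k := by
    rw [← mul_pow, hy]
    congr 1
    field_simp
  rw [hx', ← mul_assoc]
  gcongr
  calc (1 / 4 : ℝ) ^ (k / t) * y ^ k ≤ (1 / 4 : ℝ) ^ (k / t) * 4 ^ (k / t + 1) := by gcongr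
    _ = 4 := by rw [pow_succ, ← mul_assoc, ← mul_pow]; norm_num

/-- With s = t/(t + 1) the sum is s²/(1 - s)², which is exactly t²; this is the reason for that
ratio. -/
theorem hasSum_coe_mul_ratio_pow {t : ℕ} (ht : 1 ≤ t) :
    HasSum (fun k : ℕ => (k : ℝ) * ((t : ℝ) / (t + 1)) ^ (k + 1)) ((t : ℝ) ^ 2) := by
  have ht0 : (0 : ℝ) < t := by exact_mod_cast ht
  have hs : ‖(t : ℝ) / (t + 1)‖ < 1 := by
    rw [Real.norm_of_nonneg (by positivity), div_lt_one (by positivity)]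
    linarith
  have h := (hasSum_coe_mul_geometric_of_norm_lt_one hs).mul_right ((t : ℝ) / (t + 1))
  have e : (t : ℝ) / (t + 1) / (1 - (t : ℝ) / (t + 1)) ^ 2 * ((t : ℝ) / (t + 1)) = (t : ℝ) ^ 2 := by
    have : (1 - (t : ℝ) / (t + 1)) = 1 / (t + 1) := by field_simp; ring
    rw [this]
    field_simp
  rw [e] at h
  exact h.congr_fun fun k => by rw [pow_succ, mul_assoc]

/-- The bound (1 + x)ᵏ - 1 is the one that survives the induction; the factor x extracted afterwards
makes the bias error first order in α. -/
theorem norm_one_sub_pow_sub_one_le {R : Type*} [NormedRing R] {a : R} {x : ℝ} (ha : ‖a‖ ≤ x)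
    (k : ℕ) : ‖(1 - a) ^ k - 1‖ ≤ k * x * (1 + x) ^ k := by
  have hx : 0 ≤ x := (norm_nonneg a).trans ha
  have h : ‖(1 - a) ^ k - 1‖ ≤ (1 + x) ^ k - 1 := by
    induction k with
    | zero => simp
    | succ k ih =>
      have e : (1 - a) ^ (k + 1) - 1 = ((1 - a) ^ k - 1) - ((1 - a) ^ k - 1) * a - a := by
        rw [pow_succ]; noncomm_ring
      have h1 : ‖((1 - a) ^ k - 1) * a‖ ≤ ((1 + x) ^ k - 1) * x :=
        (norm_mul_le _ _).trans (mul_le_mul ih ha (norm_nonneg _) ((norm_nonneg _).trans ih))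
      rw [e, pow_succ]
      linarith [norm_sub_le (((1 - a) ^ k - 1) - ((1 - a) ^ k - 1) * a) a,
        norm_sub_le ((1 - a) ^ k - 1) (((1 - a) ^ k - 1) * a)]
  refine h.trans ?_
  clear h
  induction k with
  | zero => simp
  | succ k ih =>
    have hp : 0 ≤ (1 + x) ^ k := by positivity
    rw [pow_succ]
    push_cast
    nlinarith [mul_nonneg hx hp, mul_nonneg (mul_nonneg hx hx) hp,
      mul_nonneg (mul_nonneg (mul_nonneg hx hx) hp) (Nat.cast_nonneg (α := ℝ) k)]

end Geometric

/-! ### First-order expansion of the stationary mean. -/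

section Bias

variable {Z : Type*} [MeasurableSpace Z] {Q : Kernel Z Z} [IsMarkovKernel Q]
  {π : Measure Z} [IsProbabilityMeasure π] {t d : ℕ} {α C D : ℝ}
  {Abar : Matrix (Fin d) (Fin d) ℝ}
  {G : Z → Matrix (Fin d) (Fin d) ℝ} {e : Z → EuclideanSpace ℝ (Fin d)}

theorem summable_crossMoment (hπ : Q.Invariant π) (ht : 1 ≤ t) (h : HasMixingTime Q t)
    (hG : ∀ i j, Measurable fun z => G z i j) (he : Measurable e)
    (hGb : ∀ z, ‖G z‖ ≤ C) (heb : ∀ z, ‖e z‖ ≤ D) (hG0 : ∀ v, ∫ z, act (G z) v ∂π = 0) :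
    Summable fun k : ℕ => crossMoment Q π G e (k + 1) := by
  have ht0 : (0 : ℝ) < t := by exact_mod_cast ht
  have hs1 : (t : ℝ) / (t + 1) < 1 := by
    rw [div_lt_one (by positivity)]
    linarith
  have hg : Summable fun k : ℕ => C * D * (2 * (4 * ((t : ℝ) / (t + 1)) ^ (k + 1))) :=
    ((((summable_nat_add_iff 1).2
      (summable_geometric_of_lt_one (by positivity) hs1)).mul_left 4).mul_left 2).mul_left (C * D)
  refine Summable.of_norm_bounded hg fun k => ?_
  obtain ⟨z⟩ : Nonempty Z := nonempty_of_isProbabilityMeasure π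
  have hCD : 0 ≤ C * D :=
    mul_nonneg ((norm_nonneg _).trans (hGb z)) ((norm_nonneg _).trans (heb z))
  refine (norm_crossMoment_le hπ h hG he hGb heb hG0 π (Nat.le_add_left 1 k)).trans ?_
  have h1 := quarter_pow_div_mul_le (x := 0) le_rfl ht (by simp) (k + 1)
  rw [add_zero, one_pow, mul_one] at h1
  gcongr

theorem crossMoment_act_sub_one (hG : ∀ i j, Measurable fun z => G z i j) (he : Measurable e)
    (hGb : ∀ z, ‖G z‖ ≤ C) (heb : ∀ z, ‖e z‖ ≤ D) (M : Matrix (Fin d) (Fin d) ℝ) (k : ℕ) :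
    crossMoment Q π G (fun z => act M (e z)) k - crossMoment Q π G e k
      = crossMoment Q π G (fun z => act (M - 1) (e z)) k := by
  have h1 : Integrable (fun p : Z × Z => act (G p.2) (act M (e p.1))) (π ⊗ₘ (Q ^ k)) :=
    integrable_of_bound (stronglyMeasurable_act_prod (e := fun z => act M (e z)) hG
      (measurable_act_const _ he)) fun p =>
      norm_act_le_of_le (hGb p.2) (norm_act_le_of_le le_rfl (heb p.1))
  have h2 : Integrable (fun p : Z × Z => act (G p.2) (e p.1)) (π ⊗ₘ (Q ^ k)) :=
    integrable_of_bound (stronglyMeasurable_act_prod hG he) fun p =>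
      norm_act_le_of_le (hGb p.2) (heb p.1)
  rw [crossMoment, crossMoment, crossMoment, ← integral_sub h1 h2]
  refine integral_congr_ae (Eventually.of_forall fun p => ?_)
  change _ = act (G p.2) (act (M - 1) (e p.1))
  rw [act_sub, act_one, act_vec_sub]

/-- Two gains multiply: Bᵏ - 1 is of order kα up to the growth (1 + αC)ᵏ, and the correlation at lag
k + 1 decays by mixing. The 8 is 2 from total variation times 4 from `quarter_pow_div_mul_le`. -/
theorem norm_crossMoment_pow_sub_one_le (hπ : Q.Invariant π) (ht : 1 ≤ t)
    (h : HasMixingTime Q t) (hG : ∀ i j, Measurable fun z => G z i j) (he : Measurable e)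
    (hGb : ∀ z, ‖G z‖ ≤ C) (heb : ∀ z, ‖e z‖ ≤ D) (hG0 : ∀ v, ∫ z, act (G z) v ∂π = 0)
    (hα : 0 ≤ α) (hA : ‖Abar‖ ≤ C) (hαC : α * C * t ≤ 1 / 8) (k : ℕ) :
    ‖crossMoment Q π G (fun z => act ((1 - α • Abar) ^ k - 1) (e z)) (k + 1)‖
      ≤ 8 * α * C ^ 2 * D * (k * ((t : ℝ) / (t + 1)) ^ (k + 1)) := by
  obtain ⟨z⟩ : Nonempty Z := nonempty_of_isProbabilityMeasure π
  have hC : 0 ≤ C := (norm_nonneg _).trans hA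
  have hD : 0 ≤ D := (norm_nonneg _).trans (heb z)
  have hx : 0 ≤ α * C := mul_nonneg hα hC
  have ha : ‖α • Abar‖ ≤ α * C := by
    rw [norm_smul, Real.norm_of_nonneg hα]
    gcongr
  have hM := norm_one_sub_pow_sub_one_le ha k
  have heM : ∀ z, ‖act ((1 - α • Abar) ^ k - 1) (e z)‖ ≤ k * (α * C) * (1 + α * C) ^ k * D :=
    fun z => norm_act_le_of_le hM (heb z)
  have hme : Measurable fun z => act ((1 - α • Abar) ^ k - 1) (e z) := measurable_act_const _ he
  have hq := quarter_pow_div_mul_le hx ht hαC (k + 1)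
  have hq' : (1 / 4 : ℝ) ^ ((k + 1) / t) * (1 + α * C) ^ k
      ≤ 4 * ((t : ℝ) / (t + 1)) ^ (k + 1) := by
    refine le_trans ?_ hq
    gcongr
    · linarith
    · omega
  calc _ ≤ C * (k * (α * C) * (1 + α * C) ^ k * D) * (2 * (1 / 4) ^ ((k + 1) / t)) :=
        norm_crossMoment_le hπ h hG hme hGb heM hG0 π (Nat.le_add_left 1 k)
    _ = 2 * α * C ^ 2 * D * k * ((1 / 4 : ℝ) ^ ((k + 1) / t) * (1 + α * C) ^ k) := by ring
    _ ≤ 2 * α * C ^ 2 * D * k * (4 * ((t : ℝ) / (t + 1)) ^ (k + 1)) := by gcongr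
    _ = _ := by ring

/-- First-order expansion in the step size of the series giving the stationary mean. -/
theorem norm_tsum_crossMoment_sub_le (hπ : Q.Invariant π) (ht : 1 ≤ t)
    (h : HasMixingTime Q t) (hG : ∀ i j, Measurable fun z => G z i j) (he : Measurable e)
    (hGb : ∀ z, ‖G z‖ ≤ C) (heb : ∀ z, ‖e z‖ ≤ D) (hG0 : ∀ v, ∫ z, act (G z) v ∂π = 0)
    (hα : 0 ≤ α) (hA : ‖Abar‖ ≤ C) (hαC : α * C * t ≤ 1 / 8) :
    ‖∑' k : ℕ, crossMoment Q π G (fun z => act ((1 - α • Abar) ^ k) (e z)) (k + 1)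
        - ∑' k : ℕ, crossMoment Q π G e (k + 1)‖ ≤ 8 * α * C ^ 2 * D * (t : ℝ) ^ 2 := by
  have hb := fun k => norm_crossMoment_pow_sub_one_le hπ ht h hG he hGb heb hG0 hα hA hαC k
  have hsum := (hasSum_coe_mul_ratio_pow ht).mul_left (8 * α * C ^ 2 * D)
  have hdiff := fun k : ℕ => crossMoment_act_sub_one (Q := Q) (π := π) hG he hGb heb
    ((1 - α • Abar) ^ k) (k + 1)
  have h1 : Summable fun k : ℕ =>
      crossMoment Q π G (fun z => act ((1 - α • Abar) ^ k - 1) (e z)) (k + 1) :=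
    Summable.of_norm_bounded hsum.summable hb
  have h2 := summable_crossMoment hπ ht h hG he hGb heb hG0
  have h3 : Summable fun k : ℕ =>
      crossMoment Q π G (fun z => act ((1 - α • Abar) ^ k) (e z)) (k + 1) :=
    (h1.add h2).congr fun k => by rw [← hdiff, sub_add_cancel]
  rw [← h3.tsum_sub h2]
  simp only [hdiff]
  exact tsum_of_norm_bounded hsum hb

/-- With S' the exact series and S the one defining Δ, the remainder is αĀ⁻¹(S' - S). -/
theorem norm_sub_smul_act_inv_le (hA : IsUnit Abar.det) {m S S' : EuclideanSpace ℝ (Fin d)} {K : ℝ}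
    (hα : 0 ≤ α) (hm : act Abar m = α • S') (hS : ‖S' - S‖ ≤ K) :
    ‖m - α • act Abar⁻¹ S‖ ≤ ‖Abar⁻¹‖ * (α * K) := by
  have e : m - α • act Abar⁻¹ S = act Abar⁻¹ (α • (S' - S)) := by
    have h1 : act Abar⁻¹ (act Abar m) = m := by
      rw [← act_mul, Matrix.nonsing_inv_mul _ hA, act_one]
    rw [smul_sub, act_vec_sub, ← hm, h1, act_vec_smul]
  rw [e]
  refine norm_act_le_of_le le_rfl ?_
  rw [norm_smul, Real.norm_of_nonneg hα]
  gcongr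

end Bias

/-! ### Bounds by C_A and centering of Ã. -/

section Model

variable {Z : Type*} {d : ℕ} {A : Z → Matrix (Fin d) (Fin d) ℝ} {Abar : Matrix (Fin d) (Fin d) ℝ}

theorem norm_le_constA (h : BddAbove (Set.range fun z => ‖A z‖)) (z : Z) :
    ‖A z‖ ≤ constA A Abar :=
  (le_ciSup h z).trans (le_max_left _ _)

theorem norm_tildeA_le_constA (h : BddAbove (Set.range fun z => ‖tildeA A Abar z‖)) (z : Z) :
    ‖tildeA A Abar z‖ ≤ constA A Abar :=
  (le_ciSup h z).trans (le_max_right _ _)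

variable [MeasurableSpace Z] {π : Measure Z} [IsProbabilityMeasure π] {C : ℝ}

theorem integrable_act_const (hA : ∀ i j, Measurable fun z => A z i j) (hAb : ∀ z, ‖A z‖ ≤ C)
    (v : EuclideanSpace ℝ (Fin d)) : Integrable (fun z => act (A z) v) π :=
  integrable_of_bound (measurable_act hA measurable_const).stronglyMeasurable fun z =>
    norm_act_le_of_le (hAb z) le_rfl

theorem norm_entry_le (M : Matrix (Fin d) (Fin d) ℝ) (i j : Fin d) : ‖M i j‖ ≤ ‖M‖ := by
  have h1 : (act M (EuclideanSpace.single j 1)) i = M i j := by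
    simp [act]
  rw [← h1]
  refine (PiLp.norm_apply_le _ i).trans ((norm_act_le _ _).trans ?_)
  simp

theorem integral_act_const (hA : ∀ i j, Measurable fun z => A z i j) (hAb : ∀ z, ‖A z‖ ≤ C)
    (hAbar : ∀ i j, ∫ z, A z i j ∂π = Abar i j) (v : EuclideanSpace ℝ (Fin d)) :
    ∫ z, act (A z) v ∂π = act Abar v := by
  have hint : ∀ i j, Integrable (fun z => A z i j) π := fun i j =>
    integrable_of_bound (hA i j).stronglyMeasurable fun z => (norm_entry_le _ i j).trans (hAb z)
  have hE : ∀ (M : Matrix (Fin d) (Fin d) ℝ) (i : Fin d), act M v i = ∑ j, M i j * v j :=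
    fun M i => rfl
  ext i
  have h1 : (∫ z, act (A z) v ∂π) i = ∫ z, act (A z) v i ∂π :=
    ((EuclideanSpace.proj (𝕜 := ℝ) i).integral_comp_comm (integrable_act_const hA hAb v)).symm
  rw [h1, hE]
  simp only [hE]
  rw [integral_finsetSum _ fun j _ => (hint i j).mul_const _]
  simp only [integral_mul_const, hAbar]

/-- C_A is defined from A and Ã only; averaging under π shows that it bounds Ā too. -/
theorem norm_le_of_integral_eq (hA : ∀ i j, Measurable fun z => A z i j) (hAb : ∀ z, ‖A z‖ ≤ C)
    (hAbar : ∀ i j, ∫ z, A z i j ∂π = Abar i j) : ‖Abar‖ ≤ C := by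
  obtain ⟨z⟩ : Nonempty Z := nonempty_of_isProbabilityMeasure π
  refine norm_le_of_norm_act_le ((norm_nonneg _).trans (hAb z)) fun v => ?_
  rw [← integral_act_const hA hAb hAbar]
  exact norm_integral_le_of_forall fun z => norm_act_le_of_le (hAb z) le_rfl

theorem integral_act_tildeA (hA : ∀ i j, Measurable fun z => A z i j) (hAb : ∀ z, ‖A z‖ ≤ C)
    (hAbar : ∀ i j, ∫ z, A z i j ∂π = Abar i j) (v : EuclideanSpace ℝ (Fin d)) :
    ∫ z, act (tildeA A Abar z) v ∂π = 0 := by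
  have e : ∀ z, act (tildeA A Abar z) v = act (A z) v - act Abar v := fun z => act_sub _ _ _
  simp only [e]
  rw [integral_sub (integrable_act_const hA hAb v) (integrable_const _),
    integral_act_const hA hAb hAbar]
  simp

end Model

end LSA

theorem mainTheorem4 {Z : Type*} [TopologicalSpace Z] [PolishSpace Z] [MeasurableSpace Z]
    [BorelSpace Z] {d : ℕ} (hd : 1 ≤ d)
    (Q : Kernel Z Z) [IsMarkovKernel Q] (π : Measure Z) [IsProbabilityMeasure π]
    (hπ : Q.Invariant π) (tmix : ℕ) (htmix : 1 ≤ tmix) (hmix : LSA.HasMixingTime Q tmix)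
    (A : Z → Matrix (Fin d) (Fin d) ℝ) (hA : ∀ i j, Measurable fun z => A z i j)
    (b : Z → EuclideanSpace ℝ (Fin d)) (hb : Measurable b)
    (Abar : Matrix (Fin d) (Fin d) ℝ) (bbar θ : EuclideanSpace ℝ (Fin d))
    (hA_bdd : BddAbove (Set.range fun z => ‖A z‖))
    (hA_bdd' : BddAbove (Set.range fun z => ‖LSA.tildeA A Abar z‖))
    (hHurwitz : LSA.IsHurwitz (-Abar))
    (hθ : LSA.act Abar θ = bbar)
    (hAbar : ∀ i j, ∫ z, A z i j ∂π = Abar i j)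
    (hbbar : ∫ z, b z ∂π = bbar)
    (hε_bdd : BddAbove (Set.range fun z => ‖LSA.noise A b Abar bbar θ z‖))
    (α : ℝ) (hα_pos : 0 < α)
    (hα : α < LSA.alphaPB Abar (LSA.constA A Abar) tmix 2) :
    Summable (fun k : ℕ =>
      LSA.crossMoment Q π (LSA.tildeA A Abar) (LSA.noise A b Abar bbar θ) (k + 1)) ∧
    ∃ Pinf : Measure (Z × EuclideanSpace ℝ (Fin d) × EuclideanSpace ℝ (Fin d)),
      -- `Pinf` is the unique stationary distribution of `(Z_{t+1}, J_t^{(0,α)}, J_t^{(1,α)})`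
      IsProbabilityMeasure Pinf ∧
      (LSA.kernelJ1 Q α Abar (LSA.measurable_tildeA hA Abar)
        (LSA.measurable_noise hA hb Abar bbar θ)).Invariant Pinf ∧
      (∀ P' : Measure (Z × EuclideanSpace ℝ (Fin d) × EuclideanSpace ℝ (Fin d)),
        IsProbabilityMeasure P' →
        (LSA.kernelJ1 Q α Abar (LSA.measurable_tildeA hA Abar)
          (LSA.measurable_noise hA hb Abar bbar θ)).Invariant P' → P' = Pinf) ∧
      Integrable (fun y => y.2.2) Pinf ∧
      -- convergence of the means along the chain, from any initial distribution
      (∀ {Ω : Type*} [MeasurableSpace Ω] (P : Measure Ω) [IsProbabilityMeasure P]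
        (X : ℕ → Ω → Z), LSA.IsMarkovChain P Q X →
        (∀ n, Integrable (fun ω => LSA.J1 α Abar (LSA.tildeA A Abar)
          (LSA.noise A b Abar bbar θ) (fun k => X k ω) n) P) ∧
        Tendsto (fun n => ∫ ω, LSA.J1 α Abar (LSA.tildeA A Abar)
          (LSA.noise A b Abar bbar θ) (fun k => X k ω) n ∂P) atTop
          (𝓝 (∫ y, y.2.2 ∂Pinf))) ∧
      -- expansion of the stationary mean
      ∃ R : EuclideanSpace ℝ (Fin d),
        ∫ y, y.2.2 ∂Pinf
          = α • LSA.biasCoeff Q π Abar (LSA.tildeA A Abar) (LSA.noise A b Abar bbar θ) + R ∧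
        ‖R‖ ≤ 12 * ‖Abar⁻¹‖ * LSA.constA A Abar ^ 2 * (tmix : ℝ) ^ 2 * α ^ 2
          * LSA.supNorm (LSA.noise A b Abar bbar θ) := by
  have hG := LSA.measurable_tildeA hA Abar
  have he := LSA.measurable_noise hA hb Abar bbar θ
  have hAb := LSA.norm_le_constA (Abar := Abar) hA_bdd
  have hGb := LSA.norm_tildeA_le_constA hA_bdd'
  have heb : ∀ z, ‖LSA.noise A b Abar bbar θ z‖ ≤ LSA.supNorm (LSA.noise A b Abar bbar θ) :=
    fun z => le_ciSup hε_bdd z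
  have hG0 := LSA.integral_act_tildeA hA hAb hAbar
  have hAC := LSA.norm_le_of_integral_eq hA hAb hAbar
  obtain ⟨hα1, hα2⟩ := LSA.stepSize_bounds hd hHurwitz hAC htmix hα_pos hα
  -- These constants depend on α; they give convergence and do not appear in the final bound.
  obtain ⟨c, r, hc, hr0, hr1, hB⟩ := LSA.exists_norm_pow_le hd hHurwitz hα_pos hα1
  obtain ⟨P, hPprob, hP, hlaw⟩ := LSA.exists_backward_law hπ
  have hF := LSA.measurable_pastState hr0 hr1 hB heb hGb he hG
  have hprob : IsProbabilityMeasure (P.map (LSA.pastState α Abar (LSA.tildeA A Abar)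
      (LSA.noise A b Abar bbar θ))) := Measure.isProbabilityMeasure_map hF.aemeasurable
  have hinv := LSA.invariant_map_pastState hr0 hr1 hB heb hGb he hG hP
  obtain ⟨hint, hm⟩ := LSA.act_integral_pastState hα_pos.ne' hr0 hr1 hB heb hGb he hG hP hlaw
  refine ⟨LSA.summable_crossMoment hπ htmix hmix hG he hGb heb hG0, _, hprob, hinv,
    fun P' _ hP' => LSA.kernelJ1_invariant_unique hπ htmix hmix hG he hGb hc hr0 hr1 hB hP' hinv,
    hint, fun P' _ X hX => ⟨LSA.integrable_J1 hX.1 he hG heb hGb,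
      hX.tendsto_integral_J1 hπ htmix hmix he hG heb hGb hr0 hr1 hB hm⟩,
    _, (add_sub_cancel _ _).symm, ?_⟩
  have hR := LSA.norm_sub_smul_act_inv_le (LSA.isUnit_of_isHurwitz_neg hHurwitz) hα_pos.le hm
    (LSA.norm_tsum_crossMoment_sub_le hπ htmix hmix hG he hGb heb hG0 hα_pos.le hAC hα2)
  refine hR.trans ?_
  obtain ⟨z⟩ : Nonempty Z := nonempty_of_isProbabilityMeasure π
  have hD := (norm_nonneg _).trans (heb z)
  -- `hR` carries the constant 8; nonnegativity of this product allows 12.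
  have hpos : 0 ≤ ‖Abar⁻¹‖ * LSA.constA A Abar ^ 2 * (tmix : ℝ) ^ 2 * α ^ 2
      * LSA.supNorm (LSA.noise A b Abar bbar θ) := by positivity
  linarith
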